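/- **The category $\mathsf{TOF}$.** Composition is written in diagrammatic order ($fg$ means first $f$, then $g$), and wires are numbered from top to bottom. $\mathsf{TOF}$ is the symmetric strict monoidal category whose objects are the natural numbers, with $n\otimes m=n+m$ and unit $0$, generated by the maps $|1\rangle:0\to1$, $\langle1|:1\to0$ and $\mathsf{tof}:3\to3$, modulo the identities listed below. Write $\sigma:2\to2$ for the symmetry $c_{1,1}$. For distinct wires $i,j,k$, let $T_{ij\to k}$ denote $\mathsf{tof}$ applied with control wires $i,j$ and target wire $k$ (conjugated by symmetries where needed). Put $$\mathsf{cnot}:=(|1\rangle\otimes 1_2)\,\mathsf{tof}\,(\langle1|\otimes 1_2),\quad \mathsf{not}:=(|1\rangle\otimes 1_1)\,\mathsf{cnot}\,(\langle1|\otimes 1_1),\quad |0\rangle:=|1\rangle\,\mathsf{not},\quad \langle0|:=\mathsf{not}\,\langle1|,$$ and let $N_{i\to j}$ denote $\mathsf{cnot}$ with control wire $i$ and target wire $j$. When the target lies above the controls, the gate is conjugated by the reversal of its wires, so that $T_{32\to1}=\rho\,\mathsf{tof}\,\rho$ on three wires, where $\rho$ reverses their order, and $N_{2\to1}=\sigma\,\mathsf{cnot}\,\sigma$.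 The identities are: 1. $(|1\rangle\otimes1_2)\mathsf{tof}=|1\rangle\otimes\mathsf{cnot}$ and $\mathsf{tof}(\langle1|\otimes1_2)=\langle1|\otimes\mathsf{cnot}$; 2. $(|0\rangle\otimes1_2)\mathsf{tof}=|0\rangle\otimes1_2$ and $\mathsf{tof}(\langle0|\otimes1_2)=\langle0|\otimes1_2$; 3. on five wires, $T_{12\to3}T_{54\to3}=T_{54\to3}T_{12\to3}$; 4. on five wires, $T_{32\to1}T_{34\to5}=T_{34\to5}T_{32\to1}$; 5. on four wires, $T_{32\to1}T_{23\to4}=T_{23\to4}T_{32\to1}$; 6. on four wires, $T_{13\to4}T_{23\to4}=T_{23\to4}T_{13\to4}$; 7. $(1_2\otimes|1\rangle)N_{1\to3}(1_2\otimes\langle0|)(1_2\otimes|1\rangle)N_{2\to3}(1_2\otimes\langle0|)=(1_2\otimes|1\rangle)\mathsf{tof}(1_2\otimes\langle0|)$; 8. $(|1\rangle\langle0|)\otimes1_1=(|1\rangle\langle0|)\otimes(\langle1|\,|1\rangle)$, where $|1\rangle\langle0|:0\to0$ and $\langle1|\,|1\rangle:1\to1$ are composites in diagrammatic order; 9. $|1\rangle\langle1|=1_0$;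 10. $\mathsf{tof}\,\mathsf{tof}=1_3$; 11. on four wires, $T_{23\to4}T_{12\to3}T_{23\to4}=T_{12\to4}T_{12\to3}$; 12. on four wires, $N_{1\to2}T_{23\to4}N_{1\to2}=T_{13\to4}T_{23\to4}$; 13. on four wires, $T_{12\to3}T_{23\to4}T_{12\to3}=T_{12\to4}T_{23\to4}$; 14. on four wires, $T_{12\to3}N_{3\to4}T_{12\to3}=T_{12\to4}N_{3\to4}$; 15. $N_{1\to2}N_{2\to1}N_{1\to2}=\sigma$; 16. $\mathsf{tof}=(\sigma\otimes1_1)\,\mathsf{tof}\,(\sigma\otimes1_1)$; 17. $\kappa=(1_1\otimes\sigma\otimes1_1)\,\kappa\,(1_1\otimes\sigma\otimes1_1)$, where $\kappa:=(1_2\otimes|0\rangle\otimes1_2)\,T_{12\to3}T_{34\to5}T_{12\to3}\,(1_2\otimes\langle0|\otimes1_2):4\to4$. The *horizontal flip* $c^\circ$ of a circuit $c$ is defined by $1_n^\circ=1_n$, $(cd)^\circ=d^\circ c^\circ$, $(c\otimes d)^\circ=c^\circ\otimes d^\circ$, $c_{n,m}^\circ=c_{m,n}$, $|1\rangle^\circ=\langle1|$,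 $\langle1|^\circ=|1\rangle$ and $\mathsf{tof}^\circ=\mathsf{tof}$. The *diagonal* $\Delta_n:n\to n\otimes n$ is defined by $\Delta_0=1_0$, $\Delta_1=(1_1\otimes|0\rangle)\,\mathsf{cnot}$ (the same formula as for the diagonal of the category $\mathsf{CNOT}$ generated by $|1\rangle$, $\langle1|$ and $\mathsf{cnot}$) and, for $n>1$, $\Delta_n=(\Delta_{n-1}\otimes\Delta_1)(1_{n-1}\otimes c_{n-1,1}\otimes1_1)$. **Proposition.** $\mathsf{TOF}$ is a discrete inverse category with this structure. That is, horizontal flip of circuits induces a well-defined functor $(\_)^\circ:\mathsf{TOF}^{\mathsf{op}}\to\mathsf{TOF}$, the identity on objects, such that: * for all maps $f$, and all maps $g$ with the same domain as $f$, $$(f^\circ)^\circ=f,\qquad ff^\circ f=f,\qquad ff^\circ gg^\circ=gg^\circ ff^\circ ;$$ * $\mathsf{TOF}$ is an inverse category. That is, $\bar f:=ff^\circ$ is a restriction structure on $\mathsf{TOF}$: $\bar ff=f$, $\bar f\bar g=\bar g\bar f$ and $\overline{\bar gf}=\bar f\bar g$ whenever $f$ and $g$ have the same domain, and $h\bar k=\overline{hk}\,h$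 whenever $h$ and $k$ are composable; and every map $f$ is a partial isomorphism with partial inverse $f^\circ$: $\bar f=ff^\circ$ and $\overline{f^\circ}=f^\circ f$; * $(f\otimes g)^\circ=f^\circ\otimes g^\circ$ for all maps $f,g$, and $\Delta$ gives $\mathsf{TOF}$ inverse products. Explicitly, with $c$ the symmetry and $a$ the associator of $\mathsf{TOF}$, for all objects $A,B$: * $\Delta$ is natural: $f\Delta_B=\Delta_A(f\otimes f)$ for all $f:A\to B$; * $\Delta$ is total, equivalently separable: $\Delta_A\Delta_A^\circ=1_A$; * $\Delta$ is cocommutative: $\Delta_Ac_{A,A}=\Delta_A$; * $\Delta$ is coassociative: $\Delta_A(\Delta_A\otimes1_A)a_{A,A,A}=\Delta_A(1_A\otimes\Delta_A)$; * $\Delta$ is semi-Frobenius: $(\Delta_A\otimes1_A)a_{A,A,A}(1_A\otimes\Delta_A^\circ)=\Delta_A^\circ\Delta_A=(1_A\otimes\Delta_A)a_{A,A,A}^\circ(\Delta_A^\circ\otimes1_A)$; * $\Delta$ is uniform-copying: $\Delta_{A\otimes B}=(\Delta_A\otimes\Delta_B)\,a_{A,A,B\otimes B}(1_A\otimes a_{A,B,B}^\circ)(1_A\otimes(c_{A,B}\otimes1_B))(1_A\otimes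 a_{B,A,B})a_{A,B,A\otimes B}^\circ$; * every map of the form $ff^\circ$ with $f:A\to B$ is latchable: $\Delta_A(ff^\circ\otimes1_A)\Delta_A^\circ=ff^\circ$. -/

import Mathlib

open CategoryTheory MonoidalCategory

universe v u

section General

variable {C : Type u} [Category.{v} C]

/-- A functor `Cᵒᵖ ⥤ C` which is the identity on objects, written `f ↦ f°`. -/
structure OpFunctor (C : Type u) [Category.{v} C] where
  /-- the action `f ↦ f°` on maps -/
  dag : ∀ {X Y : C}, (X ⟶ Y) → (Y ⟶ X)
  dag_id : ∀ X : C, dag (𝟙 X) = 𝟙 X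
  dag_comp : ∀ {X Y Z : C} (f : X ⟶ Y) (g : Y ⟶ Z), dag (f ≫ g) = dag g ≫ dag f

/-- The three axioms which make `(_)°` the partial inverse operation of an inverse category. -/
structure OpFunctor.IsInverse (D : OpFunctor C) : Prop where
  dag_dag : ∀ {X Y : C} (f : X ⟶ Y), D.dag (D.dag f) = f
  comp_dag_comp : ∀ {X Y : C} (f : X ⟶ Y), f ≫ D.dag f ≫ f = f
  comm : ∀ {X Y Z : C} (f : X ⟶ Y) (g : X ⟶ Z),
    (f ≫ D.dag f) ≫ (g ≫ D.dag g) = (g ≫ D.dag g) ≫ (f ≫ D.dag f)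

/-- A restriction structure on a category. -/
structure RestrictionStructure (C : Type u) [Category.{v} C] where
  /-- the restriction of a map -/
  rst : ∀ {X Y : C}, (X ⟶ Y) → (X ⟶ X)
  rst_comp_self : ∀ {X Y : C} (f : X ⟶ Y), rst f ≫ f = f
  rst_comm : ∀ {X Y Z : C} (f : X ⟶ Y) (g : X ⟶ Z), rst f ≫ rst g = rst g ≫ rst f
  rst_rst_comp : ∀ {X Y Z : C} (f : X ⟶ Y) (g : X ⟶ Z), rst (rst g ≫ f) = rst f ≫ rst g
  comp_rst : ∀ {X Y Z : C} (f : X ⟶ Y) (g : Y ⟶ Z), f ≫ rst g = rst (f ≫ g) ≫ f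

/-- `g` is a partial inverse of `f` in a restriction category. -/
def RestrictionStructure.IsPartialInverse (R : RestrictionStructure C) {X Y : C}
    (f : X ⟶ Y) (g : Y ⟶ X) : Prop :=
  R.rst f = f ≫ g ∧ R.rst g = g ≫ f

/-- In a symmetric monoidal category with an operation `(_)°`: the tensor preserves `(_)°`, and
`Δ` is a family of diagonals that makes the category one with inverse products. -/
structure OpFunctor.IsInverseProduct [MonoidalCategory C] [SymmetricCategory C]
    (D : OpFunctor C) (Δ : ∀ A : C, A ⟶ A ⊗ A) : Prop where
  dag_tensor : ∀ {X Y X' Y' : C} (f : X ⟶ Y) (g : X' ⟶ Y'),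
    D.dag (f ⊗ₘ g) = D.dag f ⊗ₘ D.dag g
  natural : ∀ {A B : C} (f : A ⟶ B), f ≫ Δ B = Δ A ≫ (f ⊗ₘ f)
  /-- `Δ` is total; equivalently `(Δ, Δ°)` is separable -/
  total : ∀ A : C, Δ A ≫ D.dag (Δ A) = 𝟙 A
  cocommutative : ∀ A : C, Δ A ≫ (β_ A A).hom = Δ A
  coassociative : ∀ A : C, Δ A ≫ (Δ A ⊗ₘ 𝟙 A) ≫ (α_ A A A).hom = Δ A ≫ (𝟙 A ⊗ₘ Δ A)
  semiFrobenius_left : ∀ A : C,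
    ((Δ A ⊗ₘ 𝟙 A) ≫ (α_ A A A).hom) ≫ (𝟙 A ⊗ₘ D.dag (Δ A)) = D.dag (Δ A) ≫ Δ A
  semiFrobenius_right : ∀ A : C,
    ((𝟙 A ⊗ₘ Δ A) ≫ D.dag (α_ A A A).hom) ≫ (D.dag (Δ A) ⊗ₘ 𝟙 A) = D.dag (Δ A) ≫ Δ A
  uniformCopying : ∀ A B : C,
    Δ (A ⊗ B) = (Δ A ⊗ₘ Δ B) ≫
      (α_ A A (B ⊗ B)).hom ≫ (𝟙 A ⊗ₘ D.dag (α_ A B B).hom) ≫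
      (𝟙 A ⊗ₘ ((β_ A B).hom ⊗ₘ 𝟙 B)) ≫
      (𝟙 A ⊗ₘ (α_ B A B).hom) ≫ D.dag (α_ A B (A ⊗ B)).hom

end General

/-- Formal circuits with `n` input wires and `m` output wires: the terms of the language of
symmetric strict monoidal categories with objects the natural numbers, generated by the
ancillary bits `|1⟩` and `⟨1|` and the Toffoli gate. -/
inductive TofCircuit : ℕ → ℕ → Type
  | id (n : ℕ) : TofCircuit n n
  | comp {n m k : ℕ} : TofCircuit n m → TofCircuit m k → TofCircuit n k
  | tensor {n m n' m' : ℕ} : TofCircuit n m → TofCircuit n' m' → TofCircuit (n + n') (m + m')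
  | swap (n m : ℕ) : TofCircuit (n + m) (m + n)
  | oneIn : TofCircuit 0 1
  | oneOut : TofCircuit 1 0
  | tof : TofCircuit 3 3

namespace TofCircuit

/- `c ⨟ d` is `c` followed by `d`; `c ⧆ d` is `c` above `d`. -/
notation:60 c:61 " ⨟ " d:60 => TofCircuit.comp (c :) (d :)
notation:70 c:71 " ⧆ " d:70 => TofCircuit.tensor (c :) (d :)

/-- The horizontal flip of a circuit. -/
def flip : {n m : ℕ} → TofCircuit n m → TofCircuit m n
  | _, _, id n => id n
  | _, _, comp c d => comp (flip d) (flip c)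
  | _, _, tensor c d => tensor (flip c) (flip d)
  | _, _, swap n m => swap m n
  | _, _, oneIn => oneOut
  | _, _, oneOut => oneIn
  | _, _, tof => tof

/-- The identity circuit, between two numbers that are equal. -/
def cast {n m : ℕ} (h : n = m) : TofCircuit n m := h ▸ id n

/-- The controlled not gate. -/
def cnot : TofCircuit 2 2 := (oneIn ⧆ id 2) ⨟ tof ⨟ (oneOut ⧆ id 2)

/-- The not gate. -/
def not : TofCircuit 1 1 := (oneIn ⧆ id 1) ⨟ cnot ⨟ (oneOut ⧆ id 1)

/-- The ancillary bit `|0⟩`. -/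
def zeroIn : TofCircuit 0 1 := oneIn ⨟ not

/-- The ancillary bit `⟨0|`. -/
def zeroOut : TofCircuit 1 0 := not ⨟ oneOut

/-- The symmetry on two wires. -/
def sw : TofCircuit 2 2 := swap 1 1

/-- Reversal of the order of three wires. -/
def reverse3 : TofCircuit 3 3 := (sw ⧆ id 1) ⨟ (id 1 ⧆ sw) ⨟ (sw ⧆ id 1)

/-- The flipped Toffoli gate: the target is the first wire. -/
def tofUp : TofCircuit 3 3 := reverse3 ⨟ tof ⨟ reverse3

/-- The flipped controlled not gate: the target is the first wire. -/
def cnotUp : TofCircuit 2 2 := sw ⨟ cnot ⨟ sw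

/-- On three wires: controlled not with control 1 and target 3. -/
def cnot13 : TofCircuit 3 3 := (id 1 ⧆ sw) ⨟ (cnot ⧆ id 1) ⨟ (id 1 ⧆ sw)

/-- On four wires: the Toffoli gate with controls 1, 2 and target 4. -/
def tof124 : TofCircuit 4 4 := (id 2 ⧆ sw) ⨟ (tof ⧆ id 1) ⨟ (id 2 ⧆ sw)

/-- On four wires: the Toffoli gate with controls 1, 3 and target 4. -/
def tof134 : TofCircuit 4 4 := (sw ⧆ id 2) ⨟ (id 1 ⧆ tof) ⨟ (sw ⧆ id 2)

/-- The circuit for a not gate with three controls, built with one auxiliary wire. -/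
def cnot3 : TofCircuit 4 4 :=
  (id 2 ⧆ zeroIn ⧆ id 2) ⨟ (tof ⧆ id 2) ⨟ (id 2 ⧆ tof) ⨟ (tof ⧆ id 2) ⨟ (id 2 ⧆ zeroOut ⧆ id 2)

/-- The identities between circuits, besides those of symmetric strict monoidal categories,
that are imposed in `TOF`. -/
inductive Identity : {n m : ℕ} → TofCircuit n m → TofCircuit n m → Prop
  | tof1_in : Identity (n := 2) (m := 3) ((oneIn ⧆ id 2) ⨟ tof) (oneIn ⧆ cnot)
  | tof1_out : Identity (n := 3) (m := 2) (tof ⨟ (oneOut ⧆ id 2)) (oneOut ⧆ cnot)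
  | tof2_in : Identity (n := 2) (m := 3) ((zeroIn ⧆ id 2) ⨟ tof) (zeroIn ⧆ id 2)
  | tof2_out : Identity (n := 3) (m := 2) (tof ⨟ (zeroOut ⧆ id 2)) (zeroOut ⧆ id 2)
  | tof3 : Identity (n := 5) (m := 5)
      ((tof ⧆ id 2) ⨟ (id 2 ⧆ tofUp)) ((id 2 ⧆ tofUp) ⨟ (tof ⧆ id 2))
  | tof4 : Identity (n := 5) (m := 5)
      ((tofUp ⧆ id 2) ⨟ (id 2 ⧆ tof)) ((id 2 ⧆ tof) ⨟ (tofUp ⧆ id 2))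
  | tof5 : Identity (n := 4) (m := 4)
      ((tofUp ⧆ id 1) ⨟ (id 1 ⧆ tof)) ((id 1 ⧆ tof) ⨟ (tofUp ⧆ id 1))
  | tof5' : Identity (n := 4) (m := 4)
      (tof134 ⨟ (id 1 ⧆ tof)) ((id 1 ⧆ tof) ⨟ tof134)
  | tof6 : Identity (n := 2) (m := 2)
      ((id 2 ⧆ oneIn) ⨟ cnot13 ⨟ (id 2 ⧆ zeroOut) ⨟
        (id 2 ⧆ oneIn) ⨟ (id 1 ⧆ cnot) ⨟ (id 2 ⧆ zeroOut))
      ((id 2 ⧆ oneIn) ⨟ tof ⨟ (id 2 ⧆ zeroOut))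
  | tof7 : Identity (n := 1) (m := 1)
      ((oneIn ⨟ zeroOut) ⧆ id 1) ((oneIn ⨟ zeroOut) ⧆ (oneOut ⨟ oneIn))
  | tof8 : Identity (oneIn ⨟ oneOut) (id 0)
  | tof9 : Identity (tof ⨟ tof) (id 3)
  | tof10 : Identity (n := 4) (m := 4)
      ((id 1 ⧆ tof) ⨟ (tof ⧆ id 1) ⨟ (id 1 ⧆ tof)) (tof124 ⨟ (tof ⧆ id 1))
  | tof11 : Identity (n := 4) (m := 4)
      ((cnot ⧆ id 2) ⨟ (id 1 ⧆ tof) ⨟ (cnot ⧆ id 2)) (tof134 ⨟ (id 1 ⧆ tof))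
  | tof12 : Identity (n := 4) (m := 4)
      ((tof ⧆ id 1) ⨟ (id 1 ⧆ tof) ⨟ (tof ⧆ id 1)) (tof124 ⨟ (id 1 ⧆ tof))
  | tof13 : Identity (n := 4) (m := 4)
      ((tof ⧆ id 1) ⨟ (id 2 ⧆ cnot) ⨟ (tof ⧆ id 1)) (tof124 ⨟ (id 2 ⧆ cnot))
  | tof14 : Identity (cnot ⨟ cnotUp ⨟ cnot) sw
  | tof15 : Identity (n := 3) (m := 3) tof ((sw ⧆ id 1) ⨟ tof ⨟ (sw ⧆ id 1))
  | tof16 : Identity (n := 4) (m := 4)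
      cnot3 ((id 1 ⧆ sw ⧆ id 1) ⨟ cnot3 ⨟ (id 1 ⧆ sw ⧆ id 1))

/-- Equality of circuits in `TOF`: the congruence generated by the axioms of symmetric strict
monoidal categories and the identities above. -/
inductive Rel : {n m : ℕ} → TofCircuit n m → TofCircuit n m → Prop
  | refl {n m : ℕ} (c : TofCircuit n m) : Rel c c
  | symm {n m : ℕ} {c d : TofCircuit n m} : Rel c d → Rel d c
  | trans {n m : ℕ} {c d e : TofCircuit n m} : Rel c d → Rel d e → Rel c e
  | comp_congr {n m k : ℕ} {c c' : TofCircuit n m} {d d' : TofCircuit m k} :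
      Rel c c' → Rel d d' → Rel (c ⨟ d) (c' ⨟ d')
  | tensor_congr {n m n' m' : ℕ} {c c' : TofCircuit n m} {d d' : TofCircuit n' m'} :
      Rel c c' → Rel d d' → Rel (c ⧆ d) (c' ⧆ d')
  | id_comp {n m : ℕ} (c : TofCircuit n m) : Rel (id n ⨟ c) c
  | comp_id {n m : ℕ} (c : TofCircuit n m) : Rel (c ⨟ id m) c
  | assoc {n m k l : ℕ} (c : TofCircuit n m) (d : TofCircuit m k) (e : TofCircuit k l) :
      Rel ((c ⨟ d) ⨟ e) (c ⨟ (d ⨟ e))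
  | tensor_id (n m : ℕ) : Rel (id n ⧆ id m) (id (n + m))
  | tensor_comp {n m k n' m' k' : ℕ} (c : TofCircuit n m) (d : TofCircuit m k)
      (c' : TofCircuit n' m') (d' : TofCircuit m' k') :
      Rel ((c ⨟ d) ⧆ (c' ⨟ d')) ((c ⧆ c') ⨟ (d ⧆ d'))
  | tensor_assoc {n m n' m' n'' m'' : ℕ} (c : TofCircuit n m) (d : TofCircuit n' m')
      (e : TofCircuit n'' m'') :
      Rel (((c ⧆ d) ⧆ e) ⨟ cast (Nat.add_assoc m m' m''))
        (cast (Nat.add_assoc n n' n'') ⨟ (c ⧆ (d ⧆ e)))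
  | id_zero_tensor {n m : ℕ} (c : TofCircuit n m) :
      Rel ((id 0 ⧆ c) ⨟ cast (Nat.zero_add m)) (cast (Nat.zero_add n) ⨟ c)
  | tensor_id_zero {n m : ℕ} (c : TofCircuit n m) :
      Rel ((c ⧆ id 0) ⨟ cast (Nat.add_zero m)) (cast (Nat.add_zero n) ⨟ c)
  | swap_natural {n m n' m' : ℕ} (c : TofCircuit n m) (d : TofCircuit n' m') :
      Rel ((c ⧆ d) ⨟ swap m m') (swap n n' ⨟ (d ⧆ c))
  | swap_swap (n m : ℕ) : Rel (swap n m ⨟ swap m n) (id (n + m))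
  | hexagon (n m k : ℕ) :
      Rel (cast (Nat.add_assoc n m k) ⨟ swap n (m + k) ⨟ cast (Nat.add_assoc m k n))
        ((swap n m ⧆ id k) ⨟ cast (Nat.add_assoc m n k) ⨟ (id m ⧆ swap n k))
  | ofIdentity {n m : ℕ} {c d : TofCircuit n m} : Identity c d → Rel c d

/-- Equality of circuits in `TOF` is an equivalence relation. -/
instance setoid (n m : ℕ) : Setoid (TofCircuit n m) where
  r := Rel
  iseqv := ⟨Rel.refl, Rel.symm, Rel.trans⟩

theorem cast_tensor_cast {n m n' m' : ℕ} (h : n = m) (h' : n' = m') :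
    Rel (cast h ⧆ cast h') (cast (congrArg₂ (· + ·) h h')) := by
  subst h h'
  exact Rel.tensor_id _ _

theorem cast_comp_cast {n m k : ℕ} (h : n = m) (h' : m = k) :
    Rel (cast h ⨟ cast h') (cast (h.trans h')) := by
  subst h h'
  exact Rel.id_comp _

end TofCircuit

/-- The objects of the category `TOF` are the natural numbers (numbers of wires). -/
structure TOF : Type where
  wires : ℕ

namespace TOF

open TofCircuit

/-- Maps of `TOF` are circuits modulo the identities. -/
instance category : Category.{0} TOF where
  Hom X Y := Quotient (TofCircuit.setoid X.wires Y.wires)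
  id X := Quotient.mk _ (TofCircuit.id X.wires)
  comp f g := Quotient.map₂ TofCircuit.comp (fun _ _ h _ _ h' => Rel.comp_congr h h') f g
  id_comp f := Quotient.inductionOn f fun c => Quotient.sound (Rel.id_comp c)
  comp_id f := Quotient.inductionOn f fun c => Quotient.sound (Rel.comp_id c)
  assoc f g h := Quotient.inductionOn₃ f g h fun c d e => Quotient.sound (Rel.assoc c d e)

/-- The map of `TOF` given by a circuit. -/
def ofCircuit {n m : ℕ} (c : TofCircuit n m) : TOF.mk n ⟶ TOF.mk m := Quotient.mk _ c

/-- The identity map between objects with the same number of wires. -/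
def castIso {X Y : TOF} (h : X.wires = Y.wires) : X ≅ Y where
  hom := Quotient.mk _ (TofCircuit.cast h)
  inv := Quotient.mk _ (TofCircuit.cast h.symm)
  hom_inv_id := Quotient.sound (cast_comp_cast h h.symm)
  inv_hom_id := Quotient.sound (cast_comp_cast h.symm h)

/-- The tensor of two maps: one circuit above the other. -/
def tensorMap {X Y X' Y' : TOF} (f : X ⟶ Y) (g : X' ⟶ Y') :
    TOF.mk (X.wires + X'.wires) ⟶ TOF.mk (Y.wires + Y'.wires) :=
  Quotient.map₂ TofCircuit.tensor (fun _ _ h _ _ h' => Rel.tensor_congr h h') f g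

/-- The strict monoidal structure: addition on objects, juxtaposition on circuits. -/
instance monoidalStruct : MonoidalCategoryStruct TOF where
  tensorObj X Y := TOF.mk (X.wires + Y.wires)
  tensorHom f g := tensorMap f g
  whiskerLeft X _ _ f := tensorMap (𝟙 X) f
  whiskerRight f Y := tensorMap f (𝟙 Y)
  tensorUnit := TOF.mk 0
  associator X Y Z := castIso (Nat.add_assoc X.wires Y.wires Z.wires)
  leftUnitor X := castIso (Nat.zero_add X.wires)
  rightUnitor X := castIso (Nat.add_zero X.wires)

theorem castIso_tensor_castIso {X Y X' Y' : TOF} (h : X.wires = Y.wires)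
    (h' : X'.wires = Y'.wires) :
    tensorMap (castIso h).hom (castIso h').hom =
      (castIso (X := X ⊗ X') (Y := Y ⊗ Y') (congrArg₂ (· + ·) h h')).hom :=
  Quotient.sound (cast_tensor_cast h h')

theorem castIso_comp_castIso {X Y Z : TOF} (h : X.wires = Y.wires) (h' : Y.wires = Z.wires) :
    (castIso h).hom ≫ (castIso h').hom = (castIso (h.trans h')).hom :=
  Quotient.sound (cast_comp_cast h h')

theorem castIso_refl (X : TOF) : (castIso (X := X) rfl).hom = 𝟙 X := rfl

instance monoidal : MonoidalCategory TOF := MonoidalCategory.ofTensorHom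
  (id_tensorHom_id := fun X Y => Quotient.sound (Rel.tensor_id X.wires Y.wires))
  (id_tensorHom := fun _ _ _ _ => rfl)
  (tensorHom_id := fun _ _ => rfl)
  (tensorHom_comp_tensorHom := fun f g h k =>
    Quotient.inductionOn₂ f g fun a b => Quotient.inductionOn₂ h k fun c d =>
      Quotient.sound (Rel.symm (Rel.tensor_comp a c b d)))
  (associator_naturality := fun f g h => Quotient.inductionOn₃ f g h fun c d e =>
    Quotient.sound (Rel.tensor_assoc c d e))
  (leftUnitor_naturality := fun f => Quotient.inductionOn f fun c =>
    Quotient.sound (Rel.id_zero_tensor c))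
  (rightUnitor_naturality := fun f => Quotient.inductionOn f fun c =>
    Quotient.sound (Rel.tensor_id_zero c))
  (pentagon := by
    intro W X Y Z
    change tensorMap (castIso _).hom (castIso rfl).hom ≫ (castIso _).hom ≫
      tensorMap (castIso rfl).hom (castIso _).hom = (castIso _).hom ≫ (castIso _).hom
    rw [castIso_tensor_castIso, castIso_tensor_castIso]
    erw [castIso_comp_castIso, castIso_comp_castIso, castIso_comp_castIso])
  (triangle := by
    intro X Y
    change (castIso _).hom ≫ tensorMap (castIso rfl).hom (castIso _).hom =
      tensorMap (castIso _).hom (castIso rfl).hom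
    rw [castIso_tensor_castIso, castIso_tensor_castIso]
    erw [castIso_comp_castIso])

/-- The symmetry. -/
def braid (X Y : TOF) : X ⊗ Y ≅ Y ⊗ X where
  hom := Quotient.mk _ (TofCircuit.swap X.wires Y.wires)
  inv := Quotient.mk _ (TofCircuit.swap Y.wires X.wires)
  hom_inv_id := Quotient.sound (Rel.swap_swap X.wires Y.wires)
  inv_hom_id := Quotient.sound (Rel.swap_swap Y.wires X.wires)

theorem braid_hexagon (X Y Z : TOF) :
    (α_ X Y Z).hom ≫ (braid X (Y ⊗ Z)).hom ≫ (α_ Y Z X).hom =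
      ((braid X Y).hom ▷ Z) ≫ (α_ Y X Z).hom ≫ (Y ◁ (braid X Z).hom) :=
  Quotient.sound (Rel.hexagon X.wires Y.wires Z.wires)

theorem braid_natural {X Y X' Y' : TOF} (f : X ⟶ Y) (g : X' ⟶ Y') :
    (f ⊗ₘ g) ≫ (braid Y Y').hom = (braid X X').hom ≫ (g ⊗ₘ f) :=
  Quotient.inductionOn₂ f g fun c d => Quotient.sound (Rel.swap_natural c d)

instance symmetric : SymmetricCategory TOF where
  braiding := braid
  braiding_naturality_right X Y Z f := braid_natural (𝟙 X) f
  braiding_naturality_left f Z := braid_natural f (𝟙 Z)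
  hexagon_forward X Y Z := braid_hexagon X Y Z
  hexagon_reverse X Y Z := by
    have h : α_ Z X Y ≪≫ braid Z (X ⊗ Y) ≪≫ α_ X Y Z =
        whiskerRightIso (braid Z X) Y ≪≫ α_ X Z Y ≪≫ whiskerLeftIso X (braid Z Y) :=
      Iso.ext (braid_hexagon Z X Y)
    have h' := congrArg Iso.inv h
    simp only [Iso.trans_inv, whiskerRightIso_inv, whiskerLeftIso_inv, Category.assoc] at h'
    exact h'
  symmetry X Y := (braid X Y).hom_inv_id

/-- The diagonal on one wire: `|0⟩` is added below and a controlled not gate is applied. -/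
def diagonalOne : TOF.mk 1 ⟶ TOF.mk 1 ⊗ TOF.mk 1 :=
  ofCircuit ((TofCircuit.id 1 ⧆ zeroIn) ⨟ cnot)

/-- Two diagonals put side by side, with the two middle blocks of wires exchanged. -/
def diagonalTensor {X Y : TOF} (d : X ⟶ X ⊗ X) (e : Y ⟶ Y ⊗ Y) :
    X ⊗ Y ⟶ (X ⊗ Y) ⊗ (X ⊗ Y) :=
  (d ⊗ₘ e) ≫ tensorμ X X Y Y

/-- The diagonal on `n` wires, built for `n > 1` from those on `n - 1` wires and on one wire. -/
def diagonalNat : (n : ℕ) → (TOF.mk n ⟶ TOF.mk n ⊗ TOF.mk n)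
  | 0 => 𝟙 (TOF.mk 0)
  | 1 => diagonalOne
  | n + 2 => diagonalTensor (X := TOF.mk (n + 1)) (Y := TOF.mk 1) (diagonalNat (n + 1)) diagonalOne

/-- The diagonal of `TOF`. -/
def diagonal (X : TOF) : X ⟶ X ⊗ X := diagonalNat X.wires

end TOF

/-! The flip descends to `TOF` because most identities relate circuits whose flip is their inverse:
two such circuits that are equal have equal flips, by uniqueness of inverses (`Unitary.flip_eq`).
The identities with ancillae that remain are either exchanged by the flip or self-dual; the only
delicate one, the product of two capped controlled nots, needs that a not slides through the target
of a gate (`gtof_not_target`).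

The rest is an induction over circuits. A map `e : X ⟶ X` is latchable for a diagonal `d` if
convolution along `d` with the identity fixes it. The semi-Frobenius law turns composition of
latchable maps into convolution, and convolution is commutative, so latchable maps commute. Hence
the predicate `IsPartialIso` (`f` and `f°` are natural for the diagonals, `ff°f = f`, and `ff°`,
`f°f` are latchable) is stable under composition: commutation of `f°f` with `gg°` gives the law for
`fg`, and naturality of `f` makes `(fg)(fg)°` latchable. It is also stable under tensor and flip, so
only the generators need checking.

This requires the diagonal to be semi-Frobenius on one wire, and such structures are closed under
tensor. On one wire, coassociativity and the semi-Frobenius law both express that the control of a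
controlled not can be copied, and cocommutativity comes from writing the swap as three controlled
nots. Among the generators the substantial case is naturality for the Toffoli gate (`gtof_diag3`):
its controls can be copied, and copying its target produces two gates. The restriction axioms then
follow formally from the three axioms of an inverse category. -/

namespace TOF

open TofCircuit

-- Strict tensor calculus on numbers of wires

notation "𝕀" n:max => 𝟙 (TOF.mk n)

/-- The tensor of maps between numerical objects. -/
def tens {n m n' m' : ℕ} (f : mk n ⟶ mk m) (g : mk n' ⟶ mk m') : mk (n + n') ⟶ mk (m + m') :=
  tensorMap f g

notation:85 f:86 " ⊠ " g:85 => (tens (f :) (g :) :)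

/-- Transport of a map along equalities between its numbers of wires. -/
def reType {n m n' m' : ℕ} (h : n = n') (h' : m = m') (f : mk n ⟶ mk m) : mk n' ⟶ mk m' :=
  h ▸ h' ▸ f

/-- For numerals, both sides of an equation such as `(1 + 1) + 1 = 1 + (1 + 1)` reduce to the same
number, so rewriting with this lemma erases the transports left by strict associativity. -/
theorem reType_rfl {n m : ℕ} (h : n = n) (h' : m = m) (f : mk n ⟶ mk m) : reType h h' f = f := rfl

theorem reType_injective {n m n' m' : ℕ} (h : n = n') (h' : m = m') {f g : mk n ⟶ mk m}
    (e : reType h h' f = reType h h' g) : f = g := by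
  subst h h'
  exact e

theorem reType_eq {n m n' m' : ℕ} (h : n = n') (h' : m = m') (f : mk n ⟶ mk m) :
    reType h h' f = (castIso (X := mk n') (Y := mk n) h.symm).hom ≫ f ≫
      (castIso (X := mk m) (Y := mk m') h').hom := by
  subst h h'
  rw [castIso_refl, castIso_refl, Category.id_comp, Category.comp_id]
  rfl

section Strict

variable {n m k n' m' k' n'' m'' : ℕ}

/-- The interchange law. -/
theorem tens_comp (f : mk n ⟶ mk m) (g : mk m ⟶ mk k) (f' : mk n' ⟶ mk m') (g' : mk m' ⟶ mk k') :
    (f ⊠ f') ≫ (g ⊠ g') = (f ≫ g) ⊠ (f' ≫ g') :=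
  tensorHom_comp_tensorHom (C := TOF) f f' g g'

theorem id_tens_id (n m : ℕ) : 𝕀 n ⊠ 𝕀 m = 𝕀 (n + m) :=
  id_tensorHom_id (C := TOF) (mk n) (mk m)

theorem tens_assoc (f : mk n ⟶ mk m) (g : mk n' ⟶ mk m') (h : mk n'' ⟶ mk m'') :
    (f ⊠ g) ⊠ h =
      reType (Nat.add_assoc _ _ _).symm (Nat.add_assoc _ _ _).symm (f ⊠ (g ⊠ h)) := by
  rw [reType_eq]
  exact ((Iso.eq_comp_inv (α_ (mk m) (mk m') (mk m''))).2
    (associator_naturality (C := TOF) f g h)).trans (Category.assoc _ _ _)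

theorem zero_tens (f : mk n ⟶ mk m) :
    𝕀 0 ⊠ f = reType (Nat.zero_add n).symm (Nat.zero_add m).symm f := by
  rw [reType_eq]
  exact ((Iso.eq_comp_inv (λ_ (mk m))).2
    ((congrArg (· ≫ _) (id_tensorHom (C := TOF) _ f)).trans
      (leftUnitor_naturality (C := TOF) f))).trans (Category.assoc _ _ _)

/-- No transport is needed here, in contrast with `zero_tens`, since `n + 0` reduces to `n` even for
a variable `n`. -/
theorem tens_zero (f : mk n ⟶ mk m) : f ⊠ 𝕀 0 = f :=
  ((Iso.eq_comp_inv (ρ_ (mk m))).2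
    ((congrArg (· ≫ _) (tensorHom_id (C := TOF) f _)).trans
      (rightUnitor_naturality (C := TOF) f))).trans
  ((congrArg (· ≫ _) (Category.id_comp f)).trans (Category.comp_id f))

theorem tens_eq (f : mk n ⟶ mk m) (g : mk n' ⟶ mk m') : (f ⊠ 𝕀 n') ≫ (𝕀 m ⊠ g) = f ⊠ g := by
  rw [tens_comp, Category.id_comp, Category.comp_id]

theorem tens_eq' (f : mk n ⟶ mk m) (g : mk n' ⟶ mk m') : (𝕀 n ⊠ g) ≫ (f ⊠ 𝕀 m') = f ⊠ g := by
  rw [tens_comp, Category.id_comp, Category.comp_id]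

theorem tens_exchange (f : mk n ⟶ mk m) (g : mk n' ⟶ mk m') :
    (f ⊠ 𝕀 n') ≫ (𝕀 m ⊠ g) = (𝕀 n ⊠ g) ≫ (f ⊠ 𝕀 m') := by
  rw [tens_eq, tens_eq']

theorem comp_tens_id (f : mk n ⟶ mk m) (g : mk m ⟶ mk k) (n' : ℕ) :
    (f ⊠ 𝕀 n') ≫ (g ⊠ 𝕀 n') = (f ≫ g) ⊠ 𝕀 n' := by
  rw [tens_comp, Category.id_comp]

theorem id_tens_comp (f : mk n ⟶ mk m) (g : mk m ⟶ mk k) (n' : ℕ) :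
    (𝕀 n' ⊠ f) ≫ (𝕀 n' ⊠ g) = 𝕀 n' ⊠ (f ≫ g) := by
  rw [tens_comp, Category.id_comp]

/-- The symmetry. -/
def swp (n m : ℕ) : mk (n + m) ⟶ mk (m + n) := ofCircuit (swap n m)

theorem swp_natural (f : mk n ⟶ mk m) (g : mk n' ⟶ mk m') :
    (f ⊠ g) ≫ swp m m' = swp n n' ≫ (g ⊠ f) :=
  braid_natural f g

theorem swp_swp (n m : ℕ) : swp n m ≫ swp m n = 𝕀 (n + m) :=
  (braid (mk n) (mk m)).hom_inv_id

theorem swp_one_zero : (swp 1 0 : mk 1 ⟶ mk 1) = 𝕀 1 :=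
  (braiding_tensorUnit_right (C := TOF) (mk 1)).trans (Category.id_comp _)

theorem swp_zero_one : (swp 0 1 : mk 1 ⟶ mk 1) = 𝕀 1 :=
  (braiding_tensorUnit_left (C := TOF) (mk 1)).trans (Category.id_comp _)

theorem swp_zero_zero : (swp 0 0 : mk 0 ⟶ mk 0) = 𝕀 0 :=
  (braiding_tensorUnit_left (C := TOF) (mk 0)).trans (Category.id_comp _)

end Strict

/-! ### Gates and ancillary bits -/

/-- The ancillary bit `|1⟩`. -/
def ket1 : mk 0 ⟶ mk 1 := ofCircuit oneIn
/-- The ancillary bit `⟨1|`. -/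
def bra1 : mk 1 ⟶ mk 0 := ofCircuit oneOut
/-- The Toffoli gate. -/
def gtof : mk 3 ⟶ mk 3 := ofCircuit tof
/-- The controlled not gate. -/
def gcnot : mk 2 ⟶ mk 2 := ofCircuit cnot
/-- The not gate. -/
def gnot : mk 1 ⟶ mk 1 := ofCircuit TofCircuit.not
/-- The ancillary bit `|0⟩`. -/
def ket0 : mk 0 ⟶ mk 1 := ofCircuit zeroIn
/-- The ancillary bit `⟨0|`. -/
def bra0 : mk 1 ⟶ mk 0 := ofCircuit zeroOut

theorem gnot_def : gnot = (ket1 ⊠ 𝕀 1) ≫ gcnot ≫ (bra1 ⊠ 𝕀 1) := rfl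
theorem ket0_def : ket0 = ket1 ≫ gnot := rfl
theorem bra0_def : bra0 = gnot ≫ bra1 := rfl

theorem sound {n m : ℕ} {c d : TofCircuit n m} (h : Identity c d) : ofCircuit c = ofCircuit d :=
  Quotient.sound (Rel.ofIdentity h)

theorem ket1_gtof : (ket1 ⊠ 𝕀 2) ≫ gtof = ket1 ⊠ gcnot := sound Identity.tof1_in
theorem gtof_bra1 : gtof ≫ (bra1 ⊠ 𝕀 2) = bra1 ⊠ gcnot := sound Identity.tof1_out
theorem ket0_gtof : (ket0 ⊠ 𝕀 2) ≫ gtof = ket0 ⊠ 𝕀 2 := sound Identity.tof2_in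
theorem ket1_bra1 : ket1 ≫ bra1 = 𝕀 0 := sound Identity.tof8
theorem gtof_gtof : gtof ≫ gtof = 𝕀 3 := sound Identity.tof9
theorem gtof_swap_controls : gtof = (swp 1 1 ⊠ 𝕀 1) ≫ gtof ≫ (swp 1 1 ⊠ 𝕀 1) :=
  sound Identity.tof15

/-- Capping the ancilla with `⟨1|` removes it. This is how identities descend from `gtof` to `gcnot`
and from `gcnot` to `gnot`. -/
theorem ket1_tens_cancel {n m : ℕ} {f g : mk n ⟶ mk m} (h : ket1 ⊠ f = ket1 ⊠ g) : f = g := by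
  have := congrArg (· ≫ (bra1 ⊠ 𝕀 m)) h
  simp only [tens_comp, ket1_bra1, Category.comp_id, zero_tens] at this
  exact reType_injective _ _ this

theorem tens_ket1_cancel {n m : ℕ} {f g : mk n ⟶ mk m} (h : f ⊠ ket1 = g ⊠ ket1) : f = g := by
  have := congrArg (· ≫ (𝕀 m ⊠ bra1)) h
  simp only [tens_comp, ket1_bra1, Category.comp_id, tens_zero] at this
  exact this

theorem ket1_tens_gtof {n : ℕ} (f : mk n ⟶ mk 2) : (ket1 ⊠ f) ≫ gtof = ket1 ⊠ (f ≫ gcnot) := by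
  rw [← tens_eq' ket1 f, Category.assoc, ket1_gtof, tens_comp, Category.id_comp]

theorem ket0_tens_gtof {n : ℕ} (f : mk n ⟶ mk 2) : (ket0 ⊠ f) ≫ gtof = ket0 ⊠ f := by
  rw [← tens_eq' ket0 f, Category.assoc, ket0_gtof]

theorem gcnot_gcnot : gcnot ≫ gcnot = 𝕀 2 := by
  apply ket1_tens_cancel
  rw [← ket1_tens_gtof, ← Category.id_comp gcnot, ← ket1_tens_gtof, Category.assoc, gtof_gtof,
    Category.comp_id]

theorem tens_ket_swap (k : mk 0 ⟶ mk 1) : (𝕀 1 ⊠ k) ≫ swp 1 1 = k ⊠ 𝕀 1 := by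
  rw [swp_natural, swp_one_zero, Category.id_comp]

theorem ket_tens_swap (k : mk 0 ⟶ mk 1) : (k ⊠ 𝕀 1) ≫ swp 1 1 = 𝕀 1 ⊠ k := by
  rw [swp_natural, swp_zero_one, Category.id_comp]

theorem swap_tens_bra (b : mk 1 ⟶ mk 0) : swp 1 1 ≫ (𝕀 1 ⊠ b) = b ⊠ 𝕀 1 := by
  rw [← swp_natural, swp_zero_one, Category.comp_id]

theorem ket_ket_swap (k l : mk 0 ⟶ mk 1) : (k ⊠ l) ≫ swp 1 1 = l ⊠ k := by
  rw [swp_natural, swp_zero_zero, Category.id_comp]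

/-- Feed `|1⟩` to both controls of the Toffoli gate. Symmetry in the controls makes the result
invariant under swapping its first two outputs; capping the second output with `⟨1|` then gives a
not on one side and the bare controlled not on the other. -/
theorem ket1_gcnot : (ket1 ⊠ 𝕀 1) ≫ gcnot = ket1 ⊠ gnot := by
  have h1 : (ket1 ⊠ ket1 ⊠ 𝕀 1) ≫ gtof = ket1 ⊠ ((ket1 ⊠ 𝕀 1) ≫ gcnot) := ket1_tens_gtof _
  have h2 : (ket1 ⊠ ket1 ⊠ 𝕀 1) ≫ (swp 1 1 ⊠ 𝕀 1) = ket1 ⊠ ket1 ⊠ 𝕀 1 := by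
    have := tens_assoc ket1 ket1 (𝕀 1)
    rw [reType_rfl] at this
    rw [← this, tens_comp, ket_ket_swap, Category.comp_id]
  have h3 : (swp 1 1 ⊠ 𝕀 1) ≫ (𝕀 1 ⊠ bra1 ⊠ 𝕀 1) = bra1 ⊠ 𝕀 2 := by
    have h := tens_assoc (𝕀 1) bra1 (𝕀 1)
    have h' := tens_assoc bra1 (𝕀 1) (𝕀 1)
    rw [reType_rfl] at h h'
    rw [← h, tens_comp, swap_tens_bra, Category.comp_id, h', id_tens_id]
  have h4 : ket1 ⊠ ((ket1 ⊠ 𝕀 1) ≫ gcnot) = (ket1 ⊠ ((ket1 ⊠ 𝕀 1) ≫ gcnot)) ≫ (swp 1 1 ⊠ 𝕀 1) := by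
    rw [← h1]
    conv_lhs => rw [gtof_swap_controls, ← Category.assoc, h2, ← Category.assoc]
  have h5 := congrArg (· ≫ (𝕀 1 ⊠ bra1 ⊠ 𝕀 1)) h4
  simp only [Category.assoc, h3] at h5
  rw [tens_comp, tens_comp, ket1_bra1, Category.comp_id, Category.comp_id, zero_tens, reType_rfl,
    Category.assoc, ← gnot_def] at h5
  exact h5.symm

theorem ket1_tens_gcnot {n : ℕ} (f : mk n ⟶ mk 1) : (ket1 ⊠ f) ≫ gcnot = ket1 ⊠ (f ≫ gnot) := by
  rw [← tens_eq' ket1 f, Category.assoc, ket1_gcnot, tens_comp, Category.id_comp]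

theorem gnot_gnot : gnot ≫ gnot = 𝕀 1 := by
  apply ket1_tens_cancel
  rw [← ket1_tens_gcnot, ← Category.id_comp gnot, ← ket1_tens_gcnot, Category.assoc, gcnot_gcnot,
    Category.comp_id]

theorem ket0_gnot : ket0 ≫ gnot = ket1 := by
  rw [ket0_def, Category.assoc, gnot_gnot, Category.comp_id]

theorem gnot_bra0 : gnot ≫ bra0 = bra1 := by
  rw [bra0_def, ← Category.assoc, gnot_gnot, Category.id_comp]

theorem ket0_bra0 : ket0 ≫ bra0 = 𝕀 0 := by
  rw [ket0_def, Category.assoc, gnot_bra0, ket1_bra1]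

theorem ket_ket_swap_tens (k l : mk 0 ⟶ mk 1) :
    (k ⊠ l ⊠ 𝕀 1) ≫ (swp 1 1 ⊠ 𝕀 1) = l ⊠ k ⊠ 𝕀 1 := by
  have h := tens_assoc k l (𝕀 1)
  have h' := tens_assoc l k (𝕀 1)
  rw [reType_rfl] at h h'
  rw [← h, ← h', tens_comp, ket_ket_swap, Category.comp_id]

/-- A `|1⟩` added as first control makes this a statement on the Toffoli gate, where the symmetry of
the controls puts `|0⟩` first. -/
theorem ket0_gcnot : (ket0 ⊠ 𝕀 1) ≫ gcnot = ket0 ⊠ 𝕀 1 := by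
  apply ket1_tens_cancel
  rw [← ket1_tens_gtof, gtof_swap_controls, ← Category.assoc, ket_ket_swap_tens, ← Category.assoc,
    ket0_tens_gtof, ket_ket_swap_tens]

theorem ket_swap_tens (k : mk 0 ⟶ mk 1) : (k ⊠ 𝕀 2) ≫ (swp 1 1 ⊠ 𝕀 1) = 𝕀 1 ⊠ k ⊠ 𝕀 1 := by
  have h := tens_assoc k (𝕀 1) (𝕀 1)
  have h' := tens_assoc (𝕀 1) k (𝕀 1)
  rw [reType_rfl] at h h'
  rw [← h', ← id_tens_id 1 1, ← h, tens_comp, ket_tens_swap, Category.comp_id]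

theorem tens_ket_tens_swap (k : mk 0 ⟶ mk 1) :
    (𝕀 1 ⊠ k ⊠ 𝕀 1) ≫ (swp 1 1 ⊠ 𝕀 1) = k ⊠ 𝕀 2 := by
  have h := tens_assoc k (𝕀 1) (𝕀 1)
  have h' := tens_assoc (𝕀 1) k (𝕀 1)
  rw [reType_rfl] at h h'
  rw [← h', ← id_tens_id 1 1, ← h, tens_comp, tens_ket_swap, Category.comp_id]

theorem ket_tens (k : mk 0 ⟶ mk 1) (f : mk 2 ⟶ mk 2) : k ⊠ f = f ≫ (k ⊠ 𝕀 2) := by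
  rw [← tens_eq', zero_tens, reType_rfl]

theorem tens_ket1_tens_gtof : (𝕀 1 ⊠ ket1 ⊠ 𝕀 1) ≫ gtof = gcnot ≫ (𝕀 1 ⊠ ket1 ⊠ 𝕀 1) := by
  rw [gtof_swap_controls, ← Category.assoc, tens_ket_tens_swap, ← Category.assoc, ket1_gtof,
    ket_tens, Category.assoc, ket_swap_tens]

theorem ofCircuit_eq_iff {n m : ℕ} {c d : TofCircuit n m} :
    ofCircuit c = ofCircuit d ↔ Rel c d :=
  ⟨Quotient.exact, Quotient.sound (s := setoid n m)⟩

theorem ofCircuit_comp {n m k : ℕ} (c : TofCircuit n m) (d : TofCircuit m k) :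
    ofCircuit (comp c d) = ofCircuit c ≫ ofCircuit d := rfl

theorem ofCircuit_tensor {n m n' m' : ℕ} (c : TofCircuit n m) (d : TofCircuit n' m') :
    ofCircuit (tensor c d) = ofCircuit c ⊠ ofCircuit d := rfl

theorem ofCircuit_id (n : ℕ) : ofCircuit (TofCircuit.id n) = 𝕀 n := rfl

/-! ### The not gate commutes with the targets of the other gates -/

theorem ket1_ket1_tens_gtof : (ket1 ⊠ ket1 ⊠ 𝕀 1) ≫ gtof = ket1 ⊠ ket1 ⊠ gnot := by
  rw [ket1_tens_gtof, ket1_gcnot]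

theorem tens_ket_ket_reverse (k l : mk 0 ⟶ mk 1) (f : mk 1 ⟶ mk 1) :
    (f ⊠ k ⊠ l) ≫ ofCircuit reverse3 = l ⊠ k ⊠ f := by
  have e : ofCircuit reverse3 = (swp 1 1 ⊠ 𝕀 1) ≫ (𝕀 1 ⊠ swp 1 1) ≫ (swp 1 1 ⊠ 𝕀 1) := rfl
  have h1 := tens_assoc f k l
  have h2 := tens_assoc k f l
  have h3 := tens_assoc k l f
  have h4 := tens_assoc l k f
  rw [reType_rfl] at h1 h2 h3 h4
  rw [e, ← h1, ← Category.assoc, tens_comp, swp_natural, swp_one_zero, Category.id_comp,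
    Category.comp_id, h2, ← Category.assoc, tens_comp, swp_natural, swp_one_zero, Category.id_comp,
    Category.comp_id, ← h3, tens_comp, ket_ket_swap, Category.comp_id, h4]

theorem ket_ket_tens_reverse (k l : mk 0 ⟶ mk 1) (f : mk 1 ⟶ mk 1) :
    (l ⊠ k ⊠ f) ≫ ofCircuit reverse3 = f ⊠ k ⊠ l := by
  have e : ofCircuit reverse3 = (swp 1 1 ⊠ 𝕀 1) ≫ (𝕀 1 ⊠ swp 1 1) ≫ (swp 1 1 ⊠ 𝕀 1) := rfl
  have h1 := tens_assoc f k l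
  have h2 := tens_assoc k f l
  have h3 := tens_assoc k l f
  have h4 := tens_assoc l k f
  rw [reType_rfl] at h1 h2 h3 h4
  rw [e, ← h4, ← Category.assoc, tens_comp, ket_ket_swap, Category.comp_id, h3, ← Category.assoc,
    tens_comp, swp_natural, swp_zero_one, Category.id_comp, Category.comp_id, ← h2, tens_comp,
    swp_natural, swp_zero_one, Category.id_comp, Category.comp_id, h1]

theorem tens_ket1_ket1_tofUp :
    (𝕀 1 ⊠ ket1 ⊠ ket1) ≫ ofCircuit tofUp = gnot ⊠ ket1 ⊠ ket1 := by
  have e : ofCircuit tofUp = ofCircuit reverse3 ≫ gtof ≫ ofCircuit reverse3 := rfl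
  rw [e, ← Category.assoc, tens_ket_ket_reverse, ← Category.assoc, ket1_ket1_tens_gtof,
    ket_ket_tens_reverse]

/-- Two Toffoli gates sharing only their target commute; `|1⟩` on both controls of the second
reduces it to a not on that target. -/
theorem gtof_not_target : gtof ≫ (𝕀 2 ⊠ gnot) = (𝕀 2 ⊠ gnot) ≫ gtof := by
  have h : (gtof ⊠ 𝕀 2) ≫ (𝕀 2 ⊠ ofCircuit tofUp) = (𝕀 2 ⊠ ofCircuit tofUp) ≫ (gtof ⊠ 𝕀 2) :=
    sound Identity.tof3
  have e (f : mk 1 ⟶ mk 1) : 𝕀 2 ⊠ f ⊠ ket1 ⊠ ket1 = (𝕀 2 ⊠ f) ⊠ ket1 ⊠ ket1 := by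
    have := tens_assoc (𝕀 2) f (ket1 ⊠ ket1)
    rw [reType_rfl] at this
    exact this.symm
  have h1 : (𝕀 3 ⊠ ket1 ⊠ ket1) ≫ (𝕀 2 ⊠ ofCircuit tofUp) = (𝕀 2 ⊠ gnot) ⊠ ket1 ⊠ ket1 := by
    have h3 : 𝕀 3 ⊠ ket1 ⊠ ket1 = 𝕀 2 ⊠ 𝕀 1 ⊠ ket1 ⊠ ket1 := by rw [e, id_tens_id]
    rw [h3, tens_comp, tens_ket1_ket1_tofUp, Category.id_comp, e]
  have h2 := congrArg ((𝕀 3 ⊠ ket1 ⊠ ket1) ≫ ·) h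
  simp only [← Category.assoc, h1] at h2
  rw [tens_eq', ← tens_eq, Category.assoc, h1, tens_comp, Category.id_comp, tens_comp,
    Category.comp_id] at h2
  have h4 (f : mk 3 ⟶ mk 3) : f ⊠ ket1 ⊠ ket1 = (f ⊠ ket1) ⊠ ket1 := by
    have := tens_assoc f ket1 ket1
    rw [reType_rfl] at this
    exact this.symm
  rw [h4, h4] at h2
  exact tens_ket1_cancel (tens_ket1_cancel h2)

theorem gcnot_not_target : gcnot ≫ (𝕀 1 ⊠ gnot) = (𝕀 1 ⊠ gnot) ≫ gcnot := by
  have e : 𝕀 2 ⊠ gnot = 𝕀 1 ⊠ 𝕀 1 ⊠ gnot := by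
    have := tens_assoc (𝕀 1) (𝕀 1) gnot
    rwa [reType_rfl, id_tens_id] at this
  have h := congrArg ((ket1 ⊠ 𝕀 2) ≫ ·) gtof_not_target
  simp only [← Category.assoc, ket1_gtof] at h
  rw [e, tens_comp, tens_comp, Category.comp_id, Category.id_comp, ket1_tens_gtof] at h
  exact ket1_tens_cancel h

/-- The not inside `⟨0|` slides through the target and turns `|1⟩` into `|0⟩`. The flip exchanges
the two sides. -/
theorem ket1_gcnot_bra0 :
    (𝕀 1 ⊠ ket1) ≫ gcnot ≫ (𝕀 1 ⊠ bra0) = (𝕀 1 ⊠ ket0) ≫ gcnot ≫ (𝕀 1 ⊠ bra1) := by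
  rw [bra0_def, ← id_tens_comp, ← Category.assoc gcnot, gcnot_not_target, ket0_def,
    ← id_tens_comp, Category.assoc, Category.assoc]

theorem ket1_gtof_bra0 :
    (𝕀 2 ⊠ ket1) ≫ gtof ≫ (𝕀 2 ⊠ bra0) = (𝕀 2 ⊠ ket0) ≫ gtof ≫ (𝕀 2 ⊠ bra1) := by
  rw [bra0_def, ← id_tens_comp, ← Category.assoc gtof, gtof_not_target, ket0_def,
    ← id_tens_comp, Category.assoc, Category.assoc]

/-! ### Horizontal flip is well defined -/

theorem flip_flip {n m : ℕ} (c : TofCircuit n m) : c.flip.flip = c := by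
  induction c <;> simp_all [TofCircuit.flip]

theorem flip_cast {n m : ℕ} (h : n = m) : (TofCircuit.cast h).flip = TofCircuit.cast h.symm := by
  subst h
  rfl

/-- A circuit whose flip is its inverse. -/
structure Unitary {n m : ℕ} (c : TofCircuit n m) : Prop where
  comp_flip : ofCircuit c ≫ ofCircuit c.flip = 𝕀 n
  flip_comp : ofCircuit c.flip ≫ ofCircuit c = 𝕀 m

namespace Unitary

theorem id (n : ℕ) : Unitary (TofCircuit.id n) := ⟨Category.id_comp _, Category.id_comp _⟩

theorem comp {n m k : ℕ} {c : TofCircuit n m} {d : TofCircuit m k} (hc : Unitary c)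
    (hd : Unitary d) : Unitary (.comp c d) where
  comp_flip := by
    rw [TofCircuit.flip, ofCircuit_comp, ofCircuit_comp, Category.assoc,
      ← Category.assoc (ofCircuit d), hd.comp_flip, Category.id_comp, hc.comp_flip]
  flip_comp := by
    rw [TofCircuit.flip, ofCircuit_comp, ofCircuit_comp, Category.assoc,
      ← Category.assoc (ofCircuit c.flip), hc.flip_comp, Category.id_comp, hd.flip_comp]

theorem tensor {n m n' m' : ℕ} {c : TofCircuit n m} {d : TofCircuit n' m'} (hc : Unitary c)
    (hd : Unitary d) : Unitary (.tensor c d) where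
  comp_flip := by
    rw [TofCircuit.flip, ofCircuit_tensor, ofCircuit_tensor, tens_comp, hc.comp_flip,
      hd.comp_flip, id_tens_id]
  flip_comp := by
    rw [TofCircuit.flip, ofCircuit_tensor, ofCircuit_tensor, tens_comp, hc.flip_comp,
      hd.flip_comp, id_tens_id]

theorem swap (n m : ℕ) : Unitary (.swap n m) := ⟨swp_swp n m, swp_swp m n⟩

theorem cast {n m : ℕ} (h : n = m) : Unitary (.cast h) := by
  subst h
  exact id n

theorem tof : Unitary .tof := ⟨gtof_gtof, gtof_gtof⟩

theorem flip_cnot : ofCircuit cnot.flip = gcnot :=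
  Category.assoc (ket1 ⊠ 𝕀 2) gtof (bra1 ⊠ 𝕀 2)

theorem cnot : Unitary .cnot := by
  constructor <;> rw [flip_cnot] <;> exact gcnot_gcnot

/-- Uniqueness of inverses. -/
theorem flip_eq {n m : ℕ} {c d : TofCircuit n m} (hc : Unitary c) (hd : Unitary d)
    (h : ofCircuit c = ofCircuit d) : ofCircuit c.flip = ofCircuit d.flip := by
  rw [← Category.comp_id (ofCircuit c.flip), ← hd.comp_flip, ← h, ← Category.assoc,
    hc.flip_comp, Category.id_comp]

/-- Flipping reverses the casts in the strictness axioms; this moves each cast to the other side of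
the equation. -/
theorem cast_conj {n m n' m' : ℕ} (h : n = n') (h' : m = m') {c : TofCircuit m n}
    {d : TofCircuit m' n'}
    (e : ofCircuit (.comp c (.cast h)) = ofCircuit (.comp (.cast h') d)) :
    ofCircuit (.comp (TofCircuit.cast h').flip c) =
      ofCircuit (.comp d (TofCircuit.cast h).flip) := by
  subst h h'
  rw [ofCircuit_comp, ofCircuit_comp] at e ⊢
  exact (Category.id_comp _).trans (((Category.comp_id _).symm.trans e).trans
    ((Category.id_comp _).trans (Category.comp_id _).symm))

end Unitary

theorem flip_not : ofCircuit TofCircuit.not.flip = gnot := by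
  change ((ket1 ⊠ 𝕀 1) ≫ ofCircuit cnot.flip) ≫ (bra1 ⊠ 𝕀 1) = _
  rw [Unitary.flip_cnot, Category.assoc, gnot_def]

theorem flip_zeroIn : ofCircuit zeroIn.flip = bra0 :=
  congrArg (· ≫ bra1) flip_not

theorem flip_zeroOut : ofCircuit zeroOut.flip = ket0 :=
  congrArg (ket1 ≫ ·) flip_not

theorem gtof_bra0 : gtof ≫ (bra0 ⊠ 𝕀 2) = bra0 ⊠ 𝕀 2 := sound Identity.tof2_out

theorem ket1_bra0 : ket1 ≫ bra0 = ket0 ≫ bra1 := by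
  rw [ket0_def, bra0_def, Category.assoc]

theorem tens_cap_outer (k : mk 0 ⟶ mk 1) (b : mk 1 ⟶ mk 0) (f : mk 2 ⟶ mk 2) :
    (𝕀 2 ⊠ k) ≫ ((𝕀 1 ⊠ swp 1 1) ≫ (f ⊠ 𝕀 1) ≫ (𝕀 1 ⊠ swp 1 1)) ≫ (𝕀 2 ⊠ b) =
      ((𝕀 1 ⊠ k) ≫ f ≫ (𝕀 1 ⊠ b)) ⊠ 𝕀 1 := by
  have e1 : 𝕀 2 ⊠ k = 𝕀 1 ⊠ 𝕀 1 ⊠ k := by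
    have := tens_assoc (𝕀 1) (𝕀 1) k
    rwa [reType_rfl, id_tens_id] at this
  have e2 : 𝕀 2 ⊠ b = 𝕀 1 ⊠ 𝕀 1 ⊠ b := by
    have := tens_assoc (𝕀 1) (𝕀 1) b
    rwa [reType_rfl, id_tens_id] at this
  have e3 : (𝕀 2 ⊠ k) ≫ (𝕀 1 ⊠ swp 1 1) = (𝕀 1 ⊠ k) ⊠ 𝕀 1 := by
    have := tens_assoc (𝕀 1) k (𝕀 1)
    rw [reType_rfl] at this
    rw [e1, id_tens_comp, tens_ket_swap, this]
  have e4 : (𝕀 1 ⊠ swp 1 1) ≫ (𝕀 2 ⊠ b) = (𝕀 1 ⊠ b) ⊠ 𝕀 1 := by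
    have := tens_assoc (𝕀 1) b (𝕀 1)
    rw [reType_rfl] at this
    rw [e2, id_tens_comp, swap_tens_bra, this]
  simp only [Category.assoc, e4]
  rw [← Category.assoc, e3, comp_tens_id, comp_tens_id]

theorem tens_cap_inner (k : mk 0 ⟶ mk 1) (b : mk 1 ⟶ mk 0) (f : mk 2 ⟶ mk 2) :
    (𝕀 2 ⊠ k) ≫ (𝕀 1 ⊠ f) ≫ (𝕀 2 ⊠ b) = 𝕀 1 ⊠ ((𝕀 1 ⊠ k) ≫ f ≫ (𝕀 1 ⊠ b)) := by
  have e1 : 𝕀 2 ⊠ k = 𝕀 1 ⊠ 𝕀 1 ⊠ k := by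
    have := tens_assoc (𝕀 1) (𝕀 1) k
    rwa [reType_rfl, id_tens_id] at this
  have e2 : 𝕀 2 ⊠ b = 𝕀 1 ⊠ 𝕀 1 ⊠ b := by
    have := tens_assoc (𝕀 1) (𝕀 1) b
    rwa [reType_rfl, id_tens_id] at this
  rw [e1, e2, id_tens_comp, id_tens_comp]

/-- The unflipped left side is `P ⊠ P` with `P` a capped controlled not. The flip reverses the order
of two factors on different wires, which is harmless, and trades `|1⟩…⟨0|` for `|0⟩…⟨1|`, which
`ket1_gcnot_bra0` and `ket1_gtof_bra0` undo. -/
theorem flip_tof6 :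
    ((((((𝕀 2 ⊠ ofCircuit zeroOut.flip) ≫ (𝕀 1 ⊠ ofCircuit cnot.flip)) ≫ (𝕀 2 ⊠ bra1)) ≫
      (𝕀 2 ⊠ ofCircuit zeroOut.flip)) ≫ ofCircuit cnot13.flip) ≫ (𝕀 2 ⊠ bra1)) =
    ((𝕀 2 ⊠ ofCircuit zeroOut.flip) ≫ gtof) ≫ (𝕀 2 ⊠ bra1) := by
  have h : (𝕀 2 ⊠ ket1) ≫ ((𝕀 1 ⊠ swp 1 1) ≫ (gcnot ⊠ 𝕀 1) ≫ (𝕀 1 ⊠ swp 1 1)) ≫ (𝕀 2 ⊠ bra0) ≫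
      (𝕀 2 ⊠ ket1) ≫ (𝕀 1 ⊠ gcnot) ≫ (𝕀 2 ⊠ bra0) = (𝕀 2 ⊠ ket1) ≫ gtof ≫ (𝕀 2 ⊠ bra0) :=
    sound Identity.tof6
  have e : ofCircuit cnot13.flip = (𝕀 1 ⊠ swp 1 1) ≫ (gcnot ⊠ 𝕀 1) ≫ (𝕀 1 ⊠ swp 1 1) := by
    change ((𝕀 1 ⊠ swp 1 1) ≫ (ofCircuit cnot.flip ⊠ 𝕀 1)) ≫ (𝕀 1 ⊠ swp 1 1) = _
    rw [Unitary.flip_cnot, Category.assoc]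
  have h' := (tens_cap_inner ket1 bra0 gcnot)
  have h'' := (tens_cap_outer ket1 bra0 gcnot)
  have k' := (tens_cap_inner ket0 bra1 gcnot)
  have k'' := (tens_cap_outer ket0 bra1 gcnot)
  rw [h', ← Category.assoc, ← Category.assoc, Category.assoc (𝕀 2 ⊠ ket1), h'', tens_eq,
    ket1_gcnot_bra0, ket1_gtof_bra0] at h
  rw [flip_zeroOut, e, Unitary.flip_cnot, Category.assoc, Category.assoc (𝕀 2 ⊠ ket0),
    Category.assoc (𝕀 2 ⊠ ket0) gtof, ← h]
  refine Eq.trans ?_ (tens_eq' (n := 1) (m := 1) (n' := 1) (m' := 1) _ _)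
  rw [← k'', ← k']
  simp only [Category.assoc]

theorem flip_cnot3 : ofCircuit cnot3.flip = ofCircuit cnot3 := by
  change ((((𝕀 2 ⊠ ofCircuit zeroOut.flip ⊠ 𝕀 2) ≫ (gtof ⊠ 𝕀 2)) ≫ (𝕀 2 ⊠ gtof)) ≫
    (gtof ⊠ 𝕀 2)) ≫ (𝕀 2 ⊠ ofCircuit zeroIn.flip ⊠ 𝕀 2) = (𝕀 2 ⊠ ket0 ⊠ 𝕀 2) ≫ (gtof ⊠ 𝕀 2) ≫
      (𝕀 2 ⊠ gtof) ≫ (gtof ⊠ 𝕀 2) ≫ (𝕀 2 ⊠ bra0 ⊠ 𝕀 2)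
  rw [flip_zeroOut, flip_zeroIn]
  simp only [Category.assoc]

theorem flip_identity {n m : ℕ} {c d : TofCircuit n m} (h : Identity c d) :
    ofCircuit c.flip = ofCircuit d.flip := by
  have hc := Unitary.cnot
  have ht := Unitary.tof
  have hs := Unitary.swap 1 1
  have hi := Unitary.id
  have e := sound h
  cases h with
  | tof1_in =>
    change gtof ≫ (bra1 ⊠ 𝕀 2) = bra1 ⊠ ofCircuit cnot.flip
    rw [Unitary.flip_cnot, gtof_bra1]
  | tof1_out =>
    change (ket1 ⊠ 𝕀 2) ≫ gtof = ket1 ⊠ ofCircuit cnot.flip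
    rw [Unitary.flip_cnot, ket1_gtof]
  | tof2_in =>
    change gtof ≫ (ofCircuit zeroIn.flip ⊠ 𝕀 2) = ofCircuit zeroIn.flip ⊠ 𝕀 2
    rw [flip_zeroIn, gtof_bra0]
  | tof2_out =>
    change (ofCircuit zeroOut.flip ⊠ 𝕀 2) ≫ gtof = ofCircuit zeroOut.flip ⊠ 𝕀 2
    rw [flip_zeroOut, ket0_gtof]
  | tof6 => exact flip_tof6
  | tof7 =>
    have h7 : (ket1 ≫ bra0) ⊠ 𝕀 1 = (ket1 ≫ bra0) ⊠ (bra1 ≫ ket1) := e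
    change (ofCircuit zeroOut.flip ≫ bra1) ⊠ 𝕀 1 =
      (ofCircuit zeroOut.flip ≫ bra1) ⊠ (bra1 ≫ ket1)
    rw [flip_zeroOut, ← ket1_bra0, h7]
  | tof8 => exact e
  | tof16 =>
    have h16 : ofCircuit cnot3 =
      (𝕀 1 ⊠ swp 1 1 ⊠ 𝕀 1) ≫ ofCircuit cnot3 ≫ (𝕀 1 ⊠ swp 1 1 ⊠ 𝕀 1) := e
    change ofCircuit cnot3.flip =
      ((𝕀 1 ⊠ swp 1 1 ⊠ 𝕀 1) ≫ ofCircuit cnot3.flip) ≫ (𝕀 1 ⊠ swp 1 1 ⊠ 𝕀 1)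
    rw [flip_cnot3, Category.assoc, ← h16]
  -- Both sides of each remaining identity are built from identities, swaps, `tof` and `cnot`, all
  -- unitary.
  | _ =>
    refine Unitary.flip_eq ?_ ?_ e <;>
      repeat' first
        | exact hc | exact ht | exact hs | exact hi _
        | apply Unitary.comp | apply Unitary.tensor

theorem flip_congr {n m : ℕ} {c d : TofCircuit n m} (h : Rel c d) : Rel c.flip d.flip := by
  induction h with
  | refl c => exact Rel.refl _
  | symm _ ih => exact ih.symm
  | trans _ _ ih ih' => exact ih.trans ih'
  | comp_congr _ _ ih ih' => exact Rel.comp_congr ih' ih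
  | tensor_congr _ _ ih ih' => exact Rel.tensor_congr ih ih'
  | id_comp c => exact Rel.comp_id _
  | comp_id c => exact Rel.id_comp _
  | assoc c d e => exact (Rel.assoc _ _ _).symm
  | tensor_id n m => exact Rel.tensor_id _ _
  | tensor_comp c d c' d' => exact Rel.tensor_comp _ _ _ _
  | tensor_assoc c d e =>
    exact ofCircuit_eq_iff.1 (Unitary.cast_conj _ _ (ofCircuit_eq_iff.2
      (Rel.tensor_assoc c.flip d.flip e.flip)))
  | id_zero_tensor c =>
    exact ofCircuit_eq_iff.1 (Unitary.cast_conj _ _ (ofCircuit_eq_iff.2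
      (Rel.id_zero_tensor c.flip)))
  | tensor_id_zero c =>
    exact ofCircuit_eq_iff.1 (Unitary.cast_conj _ _ (ofCircuit_eq_iff.2
      (Rel.tensor_id_zero c.flip)))
  | swap_natural c d => exact (Rel.swap_natural _ _).symm
  | swap_swap n m => exact Rel.swap_swap _ _
  | hexagon n m k =>
    exact ofCircuit_eq_iff.1 (Unitary.flip_eq
      ((Unitary.cast _).comp ((Unitary.swap _ _).comp (Unitary.cast _)))
      (((Unitary.swap _ _).tensor (Unitary.id _)).comp
        ((Unitary.cast _).comp ((Unitary.id _).tensor (Unitary.swap _ _))))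
      (ofCircuit_eq_iff.2 (Rel.hexagon n m k)))
  | ofIdentity h => exact ofCircuit_eq_iff.1 (flip_identity h)

/-- Horizontal flip of circuits, as a functor `TOFᵒᵖ ⥤ TOF`. -/
def flipFunctor : OpFunctor TOF where
  dag f := Quotient.map TofCircuit.flip (fun _ _ h => flip_congr h) f
  dag_id _ := rfl
  dag_comp f g := Quotient.inductionOn₂ f g fun _ _ => rfl

end TOF

/-! ### Tensor products of diagonals in a symmetric monoidal category -/

section Abstract

variable {C : Type u} [Category.{v} C] [MonoidalCategory C] [SymmetricCategory C]

theorem tensorμ_comp_braiding_tensor (X Y : C) :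
    tensorμ X X Y Y ≫ ((β_ X Y).hom ⊗ₘ (β_ X Y).hom) =
      (β_ (X ⊗ X) (Y ⊗ Y)).hom ≫ tensorμ Y Y X X := by
  simp only [tensorμ, BraidedCategory.braiding_tensor_right_hom, BraidedCategory.braiding_tensor_left_hom]
  simp [SymmetricCategory.braiding_swap_eq_inv_braiding Y X, MonoidalCategory.tensorHom_def]

/-- The tensor of two diagonals. -/
def tensorDiag {X Y : C} (d : X ⟶ X ⊗ X) (e : Y ⟶ Y ⊗ Y) : X ⊗ Y ⟶ (X ⊗ Y) ⊗ (X ⊗ Y) :=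
  (d ⊗ₘ e) ≫ tensorμ X X Y Y

theorem tensorDiag_cocommutative {X Y : C} {d : X ⟶ X ⊗ X} {e : Y ⟶ Y ⊗ Y}
    (hd : d ≫ (β_ X X).hom = d) (he : e ≫ (β_ Y Y).hom = e) :
    tensorDiag d e ≫ (β_ (X ⊗ Y) (X ⊗ Y)).hom = tensorDiag d e := by
  rw [tensorDiag, Category.assoc, SymmetricCategory.tensorμ_braid_swap,
    tensorHom_comp_tensorHom_assoc, hd, he]

theorem tensorDiag_natural {X Y X' Y' : C} {d : X ⟶ X ⊗ X} {e : Y ⟶ Y ⊗ Y} {d' : X' ⟶ X' ⊗ X'}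
    {e' : Y' ⟶ Y' ⊗ Y'} {f : X ⟶ X'} {g : Y ⟶ Y'} (hf : f ≫ d' = d ≫ (f ⊗ₘ f))
    (hg : g ≫ e' = e ≫ (g ⊗ₘ g)) :
    (f ⊗ₘ g) ≫ tensorDiag d' e' = tensorDiag d e ≫ ((f ⊗ₘ g) ⊗ₘ (f ⊗ₘ g)) := by
  rw [tensorDiag, tensorHom_comp_tensorHom_assoc, hf, hg, tensorDiag, Category.assoc,
    ← tensorμ_natural, tensorHom_comp_tensorHom_assoc]

theorem braiding_comp_tensorDiag {X Y : C} (d : X ⟶ X ⊗ X) (e : Y ⟶ Y ⊗ Y) :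
    (β_ X Y).hom ≫ tensorDiag e d = tensorDiag d e ≫ ((β_ X Y).hom ⊗ₘ (β_ X Y).hom) := by
  rw [tensorDiag, tensorDiag, Category.assoc, tensorμ_comp_braiding_tensor,
    BraidedCategory.braiding_naturality_assoc]

/-- By `associator_monoidal` and naturality, the interleavings `tensorμ` move past the diagonals to
the end, leaving the two laws side by side. -/
theorem tensorDiag_coassociative {X Y : C} {d : X ⟶ X ⊗ X} {e : Y ⟶ Y ⊗ Y}
    (hd : d ≫ (d ⊗ₘ 𝟙 X) ≫ (α_ X X X).hom = d ≫ (𝟙 X ⊗ₘ d))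
    (he : e ≫ (e ⊗ₘ 𝟙 Y) ≫ (α_ Y Y Y).hom = e ≫ (𝟙 Y ⊗ₘ e)) :
    tensorDiag d e ≫ (tensorDiag d e ⊗ₘ 𝟙 (X ⊗ Y)) ≫ (α_ (X ⊗ Y) (X ⊗ Y) (X ⊗ Y)).hom =
      tensorDiag d e ≫ (𝟙 (X ⊗ Y) ⊗ₘ tensorDiag d e) := by
  have h := associator_monoidal X X X Y Y Y
  rw [← tensorHom_id, ← id_tensorHom] at h
  have h1 : tensorDiag d e ⊗ₘ 𝟙 (X ⊗ Y) =
      ((d ⊗ₘ e) ⊗ₘ (𝟙 X ⊗ₘ 𝟙 Y)) ≫ (tensorμ X X Y Y ⊗ₘ 𝟙 (X ⊗ Y)) := by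
    rw [tensorHom_comp_tensorHom, id_tensorHom_id, Category.id_comp, tensorDiag]
  have h2 : 𝟙 (X ⊗ Y) ⊗ₘ tensorDiag d e =
      ((𝟙 X ⊗ₘ 𝟙 Y) ⊗ₘ (d ⊗ₘ e)) ≫ (𝟙 (X ⊗ Y) ⊗ₘ tensorμ X X Y Y) := by
    rw [tensorHom_comp_tensorHom, id_tensorHom_id, Category.id_comp, tensorDiag]
  rw [h1, h2]
  conv_lhs => rw [tensorDiag]
  conv_rhs => rw [tensorDiag]
  simp only [Category.assoc]
  rw [← tensorμ_natural_assoc, h, ← tensorμ_natural_assoc]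
  simp only [tensorHom_comp_tensorHom_assoc]
  rw [hd, he]

end Abstract

/-! ### Semi-Frobenius structures, convolution and latchable maps -/

namespace OpFunctor

/-- `D` is compatible with a symmetric monoidal structure. -/
structure IsMonoidal {C : Type u} [Category.{v} C] [MonoidalCategory C] [SymmetricCategory C]
    (D : OpFunctor C) : Prop where
  dag_dag {X Y : C} (f : X ⟶ Y) : D.dag (D.dag f) = f
  dag_tensor {X Y X' Y' : C} (f : X ⟶ Y) (g : X' ⟶ Y') : D.dag (f ⊗ₘ g) = D.dag f ⊗ₘ D.dag g
  dag_associator (X Y Z : C) : D.dag (α_ X Y Z).hom = (α_ X Y Z).inv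
  dag_braiding (X Y : C) : D.dag (β_ X Y).hom = (β_ X Y).inv

/-- `d` is a special commutative semi-Frobenius structure. -/
structure IsSemiFrobenius {C : Type u} [Category.{v} C] [MonoidalCategory C] [SymmetricCategory C]
    (D : OpFunctor C) {X : C} (d : X ⟶ X ⊗ X) : Prop where
  total : d ≫ D.dag d = 𝟙 X
  cocommutative : d ≫ (β_ X X).hom = d
  coassociative : d ≫ (d ⊗ₘ 𝟙 X) ≫ (α_ X X X).hom = d ≫ (𝟙 X ⊗ₘ d)
  left : ((d ⊗ₘ 𝟙 X) ≫ (α_ X X X).hom) ≫ (𝟙 X ⊗ₘ D.dag d) = D.dag d ≫ d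

variable {C : Type u} [Category.{v} C] [MonoidalCategory C] [SymmetricCategory C] {D : OpFunctor C}

namespace IsMonoidal

theorem dag_associator_inv (hD : D.IsMonoidal) (X Y Z : C) :
    D.dag (α_ X Y Z).inv = (α_ X Y Z).hom := by
  rw [← hD.dag_associator, hD.dag_dag]

theorem dag_tensorμ (hD : D.IsMonoidal) (X₁ X₂ Y₁ Y₂ : C) :
    D.dag (tensorμ X₁ X₂ Y₁ Y₂) = tensorδ X₁ X₂ Y₁ Y₂ := by
  simp only [tensorμ, tensorδ, ← tensorHom_id, ← id_tensorHom, D.dag_comp, hD.dag_tensor,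
    hD.dag_associator, hD.dag_associator_inv, hD.dag_braiding, D.dag_id, Category.assoc]

theorem dag_tensorDiag (hD : D.IsMonoidal) {X Y : C} (d : X ⟶ X ⊗ X) (e : Y ⟶ Y ⊗ Y) :
    D.dag (tensorDiag d e) = tensorδ X X Y Y ≫ (D.dag d ⊗ₘ D.dag e) := by
  rw [tensorDiag, D.dag_comp, hD.dag_tensorμ, hD.dag_tensor]

end IsMonoidal

namespace IsSemiFrobenius

theorem tensorDiag (hD : D.IsMonoidal) {X Y : C} {d : X ⟶ X ⊗ X} {e : Y ⟶ Y ⊗ Y}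
    (hd : D.IsSemiFrobenius d) (he : D.IsSemiFrobenius e) :
    D.IsSemiFrobenius (tensorDiag d e) where
  total := by
    rw [hD.dag_tensorDiag, _root_.tensorDiag, Category.assoc, tensorμ_tensorδ_assoc,
      tensorHom_comp_tensorHom, hd.total, he.total, id_tensorHom_id]
  cocommutative := tensorDiag_cocommutative hd.cocommutative he.cocommutative
  coassociative := tensorDiag_coassociative hd.coassociative he.coassociative
  left := by
    have h := associator_monoidal X X X Y Y Y
    rw [← tensorHom_id, ← id_tensorHom] at h
    -- The compatibility of `tensorμ` with associators, conjugated by the inverse interleavings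
    -- `tensorδ`.
    have h3 : (tensorμ X X Y Y ⊗ₘ 𝟙 (X ⊗ Y)) ≫ (α_ (X ⊗ Y) (X ⊗ Y) (X ⊗ Y)).hom ≫
        (𝟙 (X ⊗ Y) ⊗ₘ tensorδ X X Y Y) =
        tensorδ (X ⊗ X) X (Y ⊗ Y) Y ≫ ((α_ X X X).hom ⊗ₘ (α_ Y Y Y).hom) ≫
          tensorμ X (X ⊗ X) Y (Y ⊗ Y) := by
      have h' := congrArg (fun t => tensorδ (X ⊗ X) X (Y ⊗ Y) Y ≫ t ≫
        (𝟙 (X ⊗ Y) ⊗ₘ tensorδ X X Y Y)) h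
      simp only [Category.assoc, tensorδ_tensorμ_assoc, tensorHom_comp_tensorHom,
        tensorμ_tensorδ, id_tensorHom_id, Category.comp_id] at h'
      exact h'
    have h1 : _root_.tensorDiag d e ⊗ₘ 𝟙 (X ⊗ Y) =
        ((d ⊗ₘ e) ⊗ₘ (𝟙 X ⊗ₘ 𝟙 Y)) ≫ (tensorμ X X Y Y ⊗ₘ 𝟙 (X ⊗ Y)) := by
      rw [tensorHom_comp_tensorHom, id_tensorHom_id, Category.id_comp, _root_.tensorDiag]
    have h2 : 𝟙 (X ⊗ Y) ⊗ₘ (tensorδ X X Y Y ≫ (D.dag d ⊗ₘ D.dag e)) =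
        (𝟙 (X ⊗ Y) ⊗ₘ tensorδ X X Y Y) ≫ ((𝟙 X ⊗ₘ 𝟙 Y) ⊗ₘ (D.dag d ⊗ₘ D.dag e)) := by
      rw [tensorHom_comp_tensorHom, id_tensorHom_id, Category.id_comp]
    have h4 : ((d ⊗ₘ e) ⊗ₘ (𝟙 X ⊗ₘ 𝟙 Y)) ≫ tensorδ (X ⊗ X) X (Y ⊗ Y) Y =
        tensorδ X X Y Y ≫ ((d ⊗ₘ 𝟙 X) ⊗ₘ (e ⊗ₘ 𝟙 Y)) := by
      have h' := congrArg (fun t => tensorδ X X Y Y ≫ t ≫ tensorδ (X ⊗ X) X (Y ⊗ Y) Y)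
        (tensorμ_natural d (𝟙 X) e (𝟙 Y))
      simp only [Category.assoc, tensorδ_tensorμ_assoc, tensorμ_tensorδ, Category.comp_id] at h'
      exact h'.symm
    rw [hD.dag_tensorDiag, h1, h2]
    simp only [Category.assoc]
    rw [reassoc_of% h3, reassoc_of% h4, ← tensorμ_natural]
    simp only [tensorHom_comp_tensorHom_assoc]
    have hl := hd.left
    have hl' := he.left
    rw [Category.assoc] at hl hl'
    rw [hl, hl', _root_.tensorDiag, tensorHom_comp_tensorHom_assoc]

/-- This is the flip of the left law. -/
theorem right (hD : D.IsMonoidal) {X : C} {d : X ⟶ X ⊗ X} (hd : D.IsSemiFrobenius d) :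
    ((𝟙 X ⊗ₘ d) ≫ D.dag (α_ X X X).hom) ≫ (D.dag d ⊗ₘ 𝟙 X) = D.dag d ≫ d := by
  have h := congrArg D.dag hd.left
  simpa only [D.dag_comp, hD.dag_tensor, hD.dag_dag, D.dag_id, Category.assoc] using h

end IsSemiFrobenius

/-- The convolution of two endomaps along a diagonal. -/
def conv (D : OpFunctor C) {X : C} (d : X ⟶ X ⊗ X) (x y : X ⟶ X) : X ⟶ X :=
  d ≫ (x ⊗ₘ y) ≫ D.dag d

namespace IsSemiFrobenius

variable {X : C} {d : X ⟶ X ⊗ X}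

theorem conv_comm (hD : D.IsMonoidal) (hd : D.IsSemiFrobenius d) (x y : X ⟶ X) :
    D.conv d x y = D.conv d y x := by
  have h : (β_ X X).hom ≫ D.dag d = D.dag d := by
    have := congrArg D.dag hd.cocommutative
    rwa [D.dag_comp, hD.dag_braiding, ← SymmetricCategory.braiding_swap_eq_inv_braiding] at this
  rw [conv, ← hd.cocommutative, Category.assoc, ← BraidedCategory.braiding_naturality_assoc,
    hd.cocommutative, h, conv]

theorem conv_assoc (hD : D.IsMonoidal) (hd : D.IsSemiFrobenius d) (x y z : X ⟶ X) :
    D.conv d (D.conv d x y) z = D.conv d x (D.conv d y z) := by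
  have h := congrArg D.dag hd.coassociative
  simp only [D.dag_comp, hD.dag_tensor, hD.dag_associator, D.dag_id, Category.assoc] at h
  have h1 : D.conv d x y ⊗ₘ z =
      (d ⊗ₘ 𝟙 X) ≫ ((x ⊗ₘ y) ⊗ₘ z) ≫ (D.dag d ⊗ₘ 𝟙 X) := by
    rw [tensorHom_comp_tensorHom, tensorHom_comp_tensorHom, Category.id_comp, Category.comp_id,
      conv]
  have h2 : x ⊗ₘ D.conv d y z =
      (𝟙 X ⊗ₘ d) ≫ (x ⊗ₘ (y ⊗ₘ z)) ≫ (𝟙 X ⊗ₘ D.dag d) := by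
    rw [tensorHom_comp_tensorHom, tensorHom_comp_tensorHom, Category.id_comp, Category.comp_id,
      conv]
  have h3 : (x ⊗ₘ y) ⊗ₘ z =
      (α_ X X X).hom ≫ (x ⊗ₘ (y ⊗ₘ z)) ≫ (α_ X X X).inv := by
    rw [← associator_naturality_assoc, Iso.hom_inv_id, Category.comp_id]
  rw [conv, h1, h3, conv, h2]
  simp only [Category.assoc]
  rw [h]
  have h4 := hd.coassociative
  rw [reassoc_of% h4]

/-- The `d° d` in the middle of the composite is opened up by the semi-Frobenius law, and
coassociativity regroups the two copies. This is what turns composition into convolution. -/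
theorem conv_comp_conv (hd : D.IsSemiFrobenius d) (x y : X ⟶ X) :
    D.conv d (𝟙 X) x ≫ D.conv d y (𝟙 X) = D.conv d y (D.conv d (𝟙 X) x) := by
  have hl := hd.left
  rw [Category.assoc] at hl
  have h2 : y ⊗ₘ D.conv d (𝟙 X) x =
      (𝟙 X ⊗ₘ d) ≫ (y ⊗ₘ (𝟙 X ⊗ₘ x)) ≫ (𝟙 X ⊗ₘ D.dag d) := by
    rw [tensorHom_comp_tensorHom, tensorHom_comp_tensorHom, Category.id_comp, Category.comp_id,
      conv]
  have h4 := hd.coassociative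
  conv_lhs => rw [conv, conv]
  conv_rhs => rw [conv, h2]
  simp only [Category.assoc]
  rw [← reassoc_of% hl, ← reassoc_of% h4]
  have h5 : (𝟙 X ⊗ₘ x) ≫ (d ⊗ₘ 𝟙 X) = (d ⊗ₘ 𝟙 X) ≫ ((𝟙 X ⊗ₘ 𝟙 X) ⊗ₘ x) := by
    rw [tensorHom_comp_tensorHom, tensorHom_comp_tensorHom, id_tensorHom_id, Category.id_comp,
      Category.comp_id, Category.id_comp, Category.comp_id]
  have h6 : (𝟙 X ⊗ₘ D.dag d) ≫ (y ⊗ₘ 𝟙 X) = (y ⊗ₘ (𝟙 X ⊗ₘ 𝟙 X)) ≫ (𝟙 X ⊗ₘ D.dag d) := by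
    rw [tensorHom_comp_tensorHom, tensorHom_comp_tensorHom, id_tensorHom_id, Category.id_comp,
      Category.comp_id, Category.id_comp, Category.comp_id]
  rw [reassoc_of% h5, reassoc_of% h6, associator_naturality_assoc,
    tensorHom_comp_tensorHom_assoc, tensorHom_comp_tensorHom, Category.id_comp,
    Category.comp_id, Category.comp_id]

end IsSemiFrobenius

/-- An endomap `e` is latchable when convolving with the identity does not change it. -/
def Latchable (D : OpFunctor C) {X : C} (d : X ⟶ X ⊗ X) (e : X ⟶ X) : Prop :=
  D.conv d e (𝟙 X) = e

namespace Latchable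

theorem id {X : C} {d : X ⟶ X ⊗ X} (hd : D.IsSemiFrobenius d) : D.Latchable d (𝟙 X) := by
  rw [Latchable, conv, id_tensorHom_id, Category.id_comp, hd.total]

theorem comp_eq_conv (hD : D.IsMonoidal) {X : C} {d : X ⟶ X ⊗ X} (hd : D.IsSemiFrobenius d)
    {e f : X ⟶ X} (he : D.Latchable d e) (hf : D.Latchable d f) : e ≫ f = D.conv d f e := by
  have h := hd.conv_comp_conv e f
  rwa [hd.conv_comm hD, he, hf] at h

theorem comm (hD : D.IsMonoidal) {X : C} {d : X ⟶ X ⊗ X} (hd : D.IsSemiFrobenius d)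
    {e f : X ⟶ X} (he : D.Latchable d e) (hf : D.Latchable d f) : e ≫ f = f ≫ e := by
  rw [he.comp_eq_conv hD hd hf, hf.comp_eq_conv hD hd he, hd.conv_comm hD]

theorem tensor (hD : D.IsMonoidal) {X Y : C} {d : X ⟶ X ⊗ X} {d' : Y ⟶ Y ⊗ Y} {e : X ⟶ X}
    {e' : Y ⟶ Y} (he : D.Latchable d e) (he' : D.Latchable d' e') :
    D.Latchable (tensorDiag d d') (e ⊗ₘ e') := by
  rw [Latchable, conv, hD.dag_tensorDiag, tensorDiag, Category.assoc, ← id_tensorHom_id,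
    ← tensorμ_natural_assoc, tensorμ_tensorδ_assoc, tensorHom_comp_tensorHom,
    tensorHom_comp_tensorHom]
  exact congrArg₂ _ he he'

theorem comp_dag (hD : D.IsMonoidal) {X Y Z : C} {d : X ⟶ X ⊗ X} {d' : Y ⟶ Y ⊗ Y}
    (hd : D.IsSemiFrobenius d) {f : X ⟶ Y} {g : Y ⟶ Z} (hn : f ≫ d' = d ≫ (f ⊗ₘ f))
    (hf : D.Latchable d (f ≫ D.dag f)) (hg : D.Latchable d' (g ≫ D.dag g)) :
    D.Latchable d ((f ≫ g) ≫ D.dag (f ≫ g)) := by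
  have hn' := congrArg D.dag hn
  rw [D.dag_comp, D.dag_comp, hD.dag_tensor] at hn'
  have e1 : (f ≫ g) ≫ D.dag (f ≫ g) = f ≫ (g ≫ D.dag g) ≫ D.dag f := by
    rw [D.dag_comp]
    simp only [Category.assoc]
  -- Write `gg°` as its convolution with the identity along `d'`, then pull `d'` and its flip back
  -- through `f` and `f°` by naturality; the identity factor becomes `ff°`, which is latchable.
  have e2 : (f ≫ g) ≫ D.dag (f ≫ g) = D.conv d ((f ≫ g) ≫ D.dag (f ≫ g)) (f ≫ D.dag f) := by
    conv_lhs => rw [e1, ← hg, conv]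
    simp only [Category.assoc]
    rw [hn', reassoc_of% hn, tensorHom_comp_tensorHom_assoc, tensorHom_comp_tensorHom_assoc]
    simp only [conv, D.dag_comp, Category.id_comp, Category.assoc]
  rw [Latchable]
  conv_lhs => rw [e2]
  rw [hd.conv_assoc hD, hf, ← e2]

end Latchable

/-! ### Partial isomorphisms with latchable idempotents -/

/-- `f` is a partial isomorphism whose two idempotents are latchable. -/
structure IsPartialIso (D : OpFunctor C) {X Y : C} (d : X ⟶ X ⊗ X) (d' : Y ⟶ Y ⊗ Y)
    (f : X ⟶ Y) : Prop where
  natural : f ≫ d' = d ≫ (f ⊗ₘ f)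
  natural_dag : D.dag f ≫ d = d' ≫ (D.dag f ⊗ₘ D.dag f)
  comp_dag_comp : f ≫ D.dag f ≫ f = f
  latch : D.Latchable d (f ≫ D.dag f)
  latch_dag : D.Latchable d' (D.dag f ≫ f)

namespace IsPartialIso

theorem dag (hD : D.IsMonoidal) {X Y : C} {d : X ⟶ X ⊗ X} {d' : Y ⟶ Y ⊗ Y} {f : X ⟶ Y}
    (hf : D.IsPartialIso d d' f) : D.IsPartialIso d' d (D.dag f) where
  natural := hf.natural_dag
  natural_dag := by rw [hD.dag_dag]; exact hf.natural
  comp_dag_comp := by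
    have := congrArg D.dag hf.comp_dag_comp
    rwa [D.dag_comp, D.dag_comp, Category.assoc] at this
  latch := by rw [hD.dag_dag]; exact hf.latch_dag
  latch_dag := by rw [hD.dag_dag]; exact hf.latch

theorem of_inverse {X Y : C} {d : X ⟶ X ⊗ X} {d' : Y ⟶ Y ⊗ Y}
    (hd : D.IsSemiFrobenius d) (hd' : D.IsSemiFrobenius d') {f : X ⟶ Y}
    (hn : f ≫ d' = d ≫ (f ⊗ₘ f)) (h : f ≫ D.dag f = 𝟙 X) (h' : D.dag f ≫ f = 𝟙 Y) :
    D.IsPartialIso d d' f where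
  natural := hn
  natural_dag := by
    have := congrArg (fun t => D.dag f ≫ t ≫ (D.dag f ⊗ₘ D.dag f)) hn
    simp only [Category.assoc, reassoc_of% h', tensorHom_comp_tensorHom, h, id_tensorHom_id,
      Category.comp_id] at this
    exact this.symm
  comp_dag_comp := by rw [h', Category.comp_id]
  latch := by rw [h]; exact .id hd
  latch_dag := by rw [h']; exact .id hd'

theorem comp (hD : D.IsMonoidal) {X Y Z : C} {d : X ⟶ X ⊗ X} {d' : Y ⟶ Y ⊗ Y} {d'' : Z ⟶ Z ⊗ Z}
    (hd : D.IsSemiFrobenius d) (hd' : D.IsSemiFrobenius d') (hd'' : D.IsSemiFrobenius d'')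
    {f : X ⟶ Y} {g : Y ⟶ Z} (hf : D.IsPartialIso d d' f) (hg : D.IsPartialIso d' d'' g) :
    D.IsPartialIso d d'' (f ≫ g) where
  natural := by
    rw [Category.assoc, hg.natural, reassoc_of% hf.natural, tensorHom_comp_tensorHom]
  natural_dag := by
    rw [D.dag_comp, Category.assoc, hf.natural_dag, reassoc_of% hg.natural_dag,
      tensorHom_comp_tensorHom]
  comp_dag_comp := by
    -- Commuting `f°f` with `gg°` turns `f gg° f°f g` into `f f°f gg° g`, which is `fg`.
    have h := hf.latch_dag.comm hD hd' hg.latch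
    have h1 := hf.comp_dag_comp
    have h2 := hg.comp_dag_comp
    simp only [Category.assoc] at h
    simp only [D.dag_comp, Category.assoc]
    rw [← reassoc_of% h, h2, reassoc_of% h1]
  latch := .comp_dag hD hd hf.natural hf.latch hg.latch
  latch_dag := by
    have := Latchable.comp_dag hD hd'' (hg.dag hD).natural (hg.dag hD).latch (hf.dag hD).latch
    rwa [← D.dag_comp, hD.dag_dag] at this

theorem tensor (hD : D.IsMonoidal) {X Y X' Y' : C} {d : X ⟶ X ⊗ X} {d' : Y ⟶ Y ⊗ Y}
    {e : X' ⟶ X' ⊗ X'} {e' : Y' ⟶ Y' ⊗ Y'} {f : X ⟶ Y} {g : X' ⟶ Y'}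
    (hf : D.IsPartialIso d d' f) (hg : D.IsPartialIso e e' g) :
    D.IsPartialIso (tensorDiag d e) (tensorDiag d' e') (f ⊗ₘ g) where
  natural := tensorDiag_natural hf.natural hg.natural
  natural_dag := by
    rw [hD.dag_tensor]
    exact tensorDiag_natural hf.natural_dag hg.natural_dag
  comp_dag_comp := by
    rw [hD.dag_tensor, tensorHom_comp_tensorHom, tensorHom_comp_tensorHom, hf.comp_dag_comp,
      hg.comp_dag_comp]
  latch := by
    rw [hD.dag_tensor, tensorHom_comp_tensorHom]
    exact hf.latch.tensor hD hg.latch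
  latch_dag := by
    rw [hD.dag_tensor, tensorHom_comp_tensorHom]
    exact hf.latch_dag.tensor hD hg.latch_dag

end IsPartialIso

/-- The restriction structure of an inverse category. -/
def IsInverse.restriction {C : Type u} [Category.{v} C] {D : OpFunctor C} (h : D.IsInverse) :
    RestrictionStructure C where
  rst f := f ≫ D.dag f
  rst_comp_self f := (Category.assoc _ _ _).trans (h.comp_dag_comp f)
  rst_comm f g := h.comm f g
  rst_rst_comp f g := by
    have e := h.comm g f
    have e' := h.comp_dag_comp g
    simp only [Category.assoc] at e
    simp only [D.dag_comp, h.dag_dag, Category.assoc]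
    rw [reassoc_of% e, reassoc_of% e']
  comp_rst f g := by
    have e := h.comm (D.dag f) g
    have e' := h.comp_dag_comp f
    simp only [h.dag_dag, Category.assoc] at e
    simp only [D.dag_comp, Category.assoc]
    rw [← e, reassoc_of% e']

end OpFunctor

namespace TOF

open TofCircuit

/-! ### Copying the wires of the gates -/

/-- The diagonal on one wire. -/
def diag1 : mk 1 ⟶ mk 2 := diagonalOne

theorem diag1_def : diag1 = (𝕀 1 ⊠ ket0) ≫ gcnot := rfl

/-- Write the swap as three controlled nots. The first cancels the one in `diag1`; the reversed one
now has `|0⟩` as control and does nothing; the third rebuilds `diag1`. -/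
theorem diag1_swap : diag1 ≫ swp 1 1 = diag1 := by
  have h : gcnot ≫ (swp 1 1 ≫ gcnot ≫ swp 1 1) ≫ gcnot = swp 1 1 := sound Identity.tof14
  rw [diag1_def, ← h]
  simp only [Category.assoc]
  have h1 := gcnot_gcnot
  rw [reassoc_of% h1, ← Category.assoc, tens_ket_swap, ← Category.assoc (ket0 ⊠ 𝕀 1), ket0_gcnot,
    ← Category.assoc, ket_tens_swap]

/-- The Toffoli gate with controls 1, 3 and target 4 on four wires. -/
def gtof134 : mk 4 ⟶ mk 4 := (swp 1 1 ⊠ 𝕀 2) ≫ (𝕀 1 ⊠ gtof) ≫ (swp 1 1 ⊠ 𝕀 2)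

/-- The Toffoli gate with controls 1, 2 and target 4 on four wires. -/
def gtof124 : mk 4 ⟶ mk 4 := (𝕀 2 ⊠ swp 1 1) ≫ (gtof ⊠ 𝕀 1) ≫ (𝕀 2 ⊠ swp 1 1)

/-- Flipping the first control of the Toffoli gate by a further wire costs one extra gate controlled
by that wire. When the flipped wire starts at `|0⟩`, only the extra gate remains, which yields the
copying of a control. -/
theorem gcnot_tens_gtof :
    (gcnot ⊠ 𝕀 2) ≫ (𝕀 1 ⊠ gtof) = (𝕀 1 ⊠ gtof) ≫ gtof134 ≫ (gcnot ⊠ 𝕀 2) := by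
  have h1 : (gcnot ⊠ 𝕀 2) ≫ (𝕀 1 ⊠ gtof) ≫ (gcnot ⊠ 𝕀 2) = gtof134 ≫ (𝕀 1 ⊠ gtof) :=
    sound Identity.tof11
  have h2 : gtof134 ≫ (𝕀 1 ⊠ gtof) = (𝕀 1 ⊠ gtof) ≫ gtof134 := sound Identity.tof5'
  have h3 : (gcnot ⊠ 𝕀 2) ≫ (gcnot ⊠ 𝕀 2) = 𝕀 4 := by
    rw [comp_tens_id, gcnot_gcnot, id_tens_id]
  rw [← Category.assoc, ← h2, ← h1, Category.assoc, Category.assoc, h3, Category.comp_id]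

theorem tens_ket_tens_gtof134 (k : mk 0 ⟶ mk 1) :
    (𝕀 1 ⊠ k ⊠ 𝕀 2) ≫ gtof134 = gtof ≫ (𝕀 1 ⊠ k ⊠ 𝕀 2) := by
  have e1 := tens_assoc (𝕀 1) k (𝕀 2)
  have e2 := tens_assoc k (𝕀 1) (𝕀 2)
  rw [reType_rfl] at e1 e2
  rw [id_tens_id] at e2
  have e3 : gtof ≫ (k ⊠ 𝕀 3) = k ⊠ gtof := by
    rw [← tens_eq' k gtof, zero_tens, reType_rfl]
  rw [gtof134, ← e1, ← Category.assoc, comp_tens_id, tens_ket_swap, e2, ← Category.assoc, tens_eq,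
    ← e3, Category.assoc, ← e2, comp_tens_id, ket_tens_swap]

theorem diag1_tens_id_two : diag1 ⊠ 𝕀 2 = (𝕀 1 ⊠ ket0 ⊠ 𝕀 2) ≫ (gcnot ⊠ 𝕀 2) := by
  have e1 := tens_assoc (𝕀 1) ket0 (𝕀 2)
  rw [reType_rfl] at e1
  rw [← e1, comp_tens_id, diag1_def]

/-- The first control wire of the Toffoli gate can be copied. -/
theorem gtof_copy_control : gtof ≫ (diag1 ⊠ 𝕀 2) = (diag1 ⊠ 𝕀 2) ≫ (𝕀 1 ⊠ gtof) := by
  have h : (𝕀 1 ⊠ ket0 ⊠ 𝕀 2) ≫ (𝕀 1 ⊠ gtof) = 𝕀 1 ⊠ ket0 ⊠ 𝕀 2 := by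
    rw [id_tens_comp, ket0_gtof]
  rw [diag1_tens_id_two, Category.assoc, gcnot_tens_gtof, ← Category.assoc (𝕀 1 ⊠ ket0 ⊠ 𝕀 2), h,
    ← Category.assoc, ← Category.assoc, tens_ket_tens_gtof134]

theorem gtof124_gtof124 : gtof124 ≫ gtof124 = 𝕀 4 := by
  have h1 : (𝕀 2 ⊠ swp 1 1) ≫ (𝕀 2 ⊠ swp 1 1) = 𝕀 4 := by
    rw [id_tens_comp, swp_swp, id_tens_id]
  have h2 : (gtof ⊠ 𝕀 1) ≫ (gtof ⊠ 𝕀 1) = 𝕀 4 := by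
    rw [comp_tens_id, gtof_gtof, id_tens_id]
  simp only [gtof124, Category.assoc, reassoc_of% h1, reassoc_of% h2, h1]

/-- The target wire of the Toffoli gate can be copied. -/
theorem gtof_copy_target :
    gtof ≫ (𝕀 2 ⊠ diag1) = (𝕀 2 ⊠ diag1) ≫ gtof124 ≫ (gtof ⊠ 𝕀 1) := by
  have h : (gtof ⊠ 𝕀 1) ≫ (𝕀 2 ⊠ gcnot) ≫ (gtof ⊠ 𝕀 1) = gtof124 ≫ (𝕀 2 ⊠ gcnot) :=
    sound Identity.tof13
  have h2 : (gtof ⊠ 𝕀 1) ≫ (gtof ⊠ 𝕀 1) = 𝕀 4 := by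
    rw [comp_tens_id, gtof_gtof, id_tens_id]
  have h3 : (𝕀 2 ⊠ gcnot) ≫ (𝕀 2 ⊠ gcnot) = 𝕀 4 := by
    rw [id_tens_comp, gcnot_gcnot, id_tens_id]
  -- By `h` the product of these two involutions is a conjugate of `𝕀 2 ⊠ gcnot` by an involution,
  -- hence itself an involution; so they commute.
  have h4 : gtof124 ≫ (𝕀 2 ⊠ gcnot) = (𝕀 2 ⊠ gcnot) ≫ gtof124 := by
    have e : (gtof124 ≫ (𝕀 2 ⊠ gcnot)) ≫ (gtof124 ≫ (𝕀 2 ⊠ gcnot)) = 𝕀 4 := by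
      rw [← h]
      simp only [Category.assoc, reassoc_of% h2, reassoc_of% h3, h2]
    have e' := congrArg (· ≫ ((𝕀 2 ⊠ gcnot) ≫ gtof124)) e
    simp only [Category.assoc, reassoc_of% h3, gtof124_gtof124, Category.comp_id,
      Category.id_comp] at e'
    exact e'
  have h5 : (gtof ⊠ 𝕀 1) ≫ (𝕀 2 ⊠ gcnot) = (𝕀 2 ⊠ gcnot) ≫ gtof124 ≫ (gtof ⊠ 𝕀 1) := by
    rw [← reassoc_of% h4, ← reassoc_of% h, h2, Category.comp_id]
  have h6 : 𝕀 2 ⊠ diag1 = (𝕀 3 ⊠ ket0) ≫ (𝕀 2 ⊠ gcnot) := by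
    have := tens_assoc (𝕀 2) (𝕀 1) ket0
    rw [reType_rfl, id_tens_id] at this
    rw [this, id_tens_comp, diag1_def]
  have h7 : gtof ≫ (𝕀 3 ⊠ ket0) = (𝕀 3 ⊠ ket0) ≫ (gtof ⊠ 𝕀 1) := by
    rw [tens_eq', ← tens_eq gtof ket0, tens_zero]
  rw [h6, reassoc_of% h7, h5, Category.assoc]

theorem gcnot_copy_control : gcnot ≫ (diag1 ⊠ 𝕀 1) = (diag1 ⊠ 𝕀 1) ≫ (𝕀 1 ⊠ gcnot) := by
  have h := congrArg ((𝕀 1 ⊠ ket1 ⊠ 𝕀 1) ≫ ·) gtof_copy_control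
  have e2 : (𝕀 1 ⊠ ket1 ⊠ 𝕀 1) ≫ (diag1 ⊠ 𝕀 2) = (diag1 ⊠ 𝕀 1) ≫ (𝕀 2 ⊠ ket1 ⊠ 𝕀 1) := by
    rw [tens_comp, tens_comp, Category.id_comp, Category.id_comp, Category.comp_id,
      Category.comp_id]
  have e3 : 𝕀 2 ⊠ ket1 ⊠ 𝕀 1 = 𝕀 1 ⊠ 𝕀 1 ⊠ ket1 ⊠ 𝕀 1 := by
    have := tens_assoc (𝕀 1) (𝕀 1) (ket1 ⊠ 𝕀 1)
    rwa [reType_rfl, id_tens_id] at this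
  have e4 : (𝕀 2 ⊠ ket1 ⊠ 𝕀 1) ≫ (𝕀 2 ⊠ bra1 ⊠ 𝕀 1) = 𝕀 3 := by
    rw [id_tens_comp, comp_tens_id, ket1_bra1, zero_tens, reType_rfl, id_tens_id]
  have e5 : (𝕀 2 ⊠ ket1 ⊠ 𝕀 1) ≫ (𝕀 1 ⊠ gtof) = (𝕀 1 ⊠ gcnot) ≫ (𝕀 2 ⊠ ket1 ⊠ 𝕀 1) := by
    rw [e3, id_tens_comp, tens_ket1_tens_gtof, id_tens_comp]
  have e6 := tens_ket1_tens_gtof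
  rw [reassoc_of% e6, e2, ← Category.assoc (𝕀 1 ⊠ ket1 ⊠ 𝕀 1), e2, Category.assoc, e5] at h
  have h' := congrArg (· ≫ (𝕀 2 ⊠ bra1 ⊠ 𝕀 1)) h
  simp only [Category.assoc, e4, Category.comp_id] at h'
  exact h'

/-- `diag1` is a controlled not with target `|0⟩`, so this is `gcnot_copy_control` with that target
supplied. -/
theorem diag1_coassoc : diag1 ≫ (diag1 ⊠ 𝕀 1) = diag1 ≫ (𝕀 1 ⊠ diag1) := by
  have e1 : (𝕀 1 ⊠ ket0) ≫ (diag1 ⊠ 𝕀 1) = diag1 ≫ (𝕀 2 ⊠ ket0) := by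
    rw [tens_eq', ← tens_eq, tens_zero]
  have e2 : 𝕀 2 ⊠ ket0 = 𝕀 1 ⊠ 𝕀 1 ⊠ ket0 := by
    have := tens_assoc (𝕀 1) (𝕀 1) ket0
    rwa [reType_rfl, id_tens_id] at this
  conv_lhs => rw [diag1_def, Category.assoc, ← diag1_def, gcnot_copy_control, ← Category.assoc, e1,
    Category.assoc, e2, id_tens_comp, ← diag1_def]

/-- The codiagonal on one wire. -/
def codiag1 : mk 2 ⟶ mk 1 := gcnot ≫ (𝕀 1 ⊠ bra0)

theorem diag1_codiag1 : diag1 ≫ codiag1 = 𝕀 1 := by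
  have h := gcnot_gcnot
  rw [diag1_def, codiag1, Category.assoc, reassoc_of% h, id_tens_comp, ket0_bra0, tens_zero]

/-- This too is `gcnot_copy_control`, with the target capped by `⟨0|`. -/
theorem diag1_semiFrobenius : (diag1 ⊠ 𝕀 1) ≫ (𝕀 1 ⊠ codiag1) = codiag1 ≫ diag1 := by
  have e1 : (diag1 ⊠ 𝕀 1) ≫ (𝕀 2 ⊠ bra0) = (𝕀 1 ⊠ bra0) ≫ diag1 := by
    rw [tens_eq, ← tens_eq', tens_zero]
  have e2 : 𝕀 2 ⊠ bra0 = 𝕀 1 ⊠ 𝕀 1 ⊠ bra0 := by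
    have := tens_assoc (𝕀 1) (𝕀 1) bra0
    rwa [reType_rfl, id_tens_id] at this
  rw [codiag1, ← id_tens_comp, ← e2, ← Category.assoc, ← gcnot_copy_control, Category.assoc, e1,
    Category.assoc]

theorem ket1_diag1 : ket1 ≫ diag1 = ket1 ⊠ ket1 := by
  have e : ket1 ≫ (𝕀 1 ⊠ ket0) = ket1 ⊠ ket0 := by rw [← tens_eq ket1, tens_zero]
  rw [diag1_def, ← Category.assoc, e, ket1_tens_gcnot, ket0_gnot]

end TOF

/-- Used to split the diagonal on `n + m` wires, defined one wire at a time, into two blocks. -/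
theorem associator_comp_tensorDiag {C : Type u} [Category.{v} C] [MonoidalCategory C]
    [SymmetricCategory C] {X Y Z : C} (d : X ⟶ X ⊗ X) (e : Y ⟶ Y ⊗ Y) (g : Z ⟶ Z ⊗ Z) :
    tensorDiag (tensorDiag d e) g ≫ ((α_ X Y Z).hom ⊗ₘ (α_ X Y Z).hom) =
      (α_ X Y Z).hom ≫ tensorDiag d (tensorDiag e g) := by
  have h := tensor_associativity X X Y Y Z Z
  rw [← tensorHom_id, ← id_tensorHom] at h
  have h1 : tensorDiag d e ⊗ₘ g = ((d ⊗ₘ e) ⊗ₘ g) ≫ (tensorμ X X Y Y ⊗ₘ 𝟙 (Z ⊗ Z)) := by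
    rw [tensorHom_comp_tensorHom, Category.comp_id, tensorDiag]
  have h2 : d ⊗ₘ tensorDiag e g = (d ⊗ₘ (e ⊗ₘ g)) ≫ (𝟙 (X ⊗ X) ⊗ₘ tensorμ Y Y Z Z) := by
    rw [tensorHom_comp_tensorHom, Category.comp_id, tensorDiag]
  rw [tensorDiag, h1, tensorDiag, h2]
  simp only [Category.assoc]
  rw [h, associator_naturality_assoc]

namespace TOF

open TofCircuit

theorem swp_one_two : swp 1 2 = (swp 1 1 ⊠ 𝕀 1) ≫ (𝕀 1 ⊠ swp 1 1) := by
  have h : 𝕀 3 ≫ swp 1 2 ≫ 𝕀 3 = (swp 1 1 ⊠ 𝕀 1) ≫ 𝕀 3 ≫ (𝕀 1 ⊠ swp 1 1) :=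
    braid_hexagon (mk 1) (mk 1) (mk 1)
  rwa [Category.id_comp, Category.comp_id, Category.id_comp] at h

theorem swp_two_one : swp 2 1 = (𝕀 1 ⊠ swp 1 1) ≫ (swp 1 1 ⊠ 𝕀 1) := by
  have h : 𝕀 3 ≫ swp 2 1 ≫ 𝕀 3 = (𝕀 1 ⊠ swp 1 1) ≫ 𝕀 3 ≫ (swp 1 1 ⊠ 𝕀 1) :=
    BraidedCategory.hexagon_reverse (mk 1) (mk 1) (mk 1)
  rwa [Category.id_comp, Category.comp_id, Category.id_comp] at h

theorem swp_two_three : swp 2 3 = (swp 2 2 ⊠ 𝕀 1) ≫ (𝕀 2 ⊠ swp 2 1) := by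
  have h : 𝕀 5 ≫ swp 2 3 ≫ 𝕀 5 = (swp 2 2 ⊠ 𝕀 1) ≫ 𝕀 5 ≫ (𝕀 2 ⊠ swp 2 1) :=
    braid_hexagon (mk 2) (mk 2) (mk 1)
  rwa [Category.id_comp, Category.comp_id, Category.id_comp] at h

theorem swp_three_one : swp 3 1 = (𝕀 2 ⊠ swp 1 1) ≫ (swp 2 1 ⊠ 𝕀 1) := by
  have h : 𝕀 4 ≫ swp 3 1 ≫ 𝕀 4 = (𝕀 2 ⊠ swp 1 1) ≫ 𝕀 4 ≫ (swp 2 1 ⊠ 𝕀 1) :=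
    BraidedCategory.hexagon_reverse (mk 2) (mk 1) (mk 1)
  rwa [Category.id_comp, Category.comp_id, Category.id_comp] at h

/-- The diagonal on two wires. -/
def diag2 : mk 2 ⟶ mk 4 := (diag1 ⊠ diag1) ≫ (𝕀 1 ⊠ swp 1 1 ⊠ 𝕀 1)

/-- The diagonal on three wires. -/
def diag3 : mk 3 ⟶ mk 6 := (diag2 ⊠ diag1) ≫ (𝕀 2 ⊠ swp 2 1 ⊠ 𝕀 1)

/-- Conjugate the copying of the first control by the symmetry of the controls. The trailing swap
puts the copy that stays outside the gate on top. -/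
theorem gtof_copy_second_control :
    gtof ≫ (𝕀 1 ⊠ diag1 ⊠ 𝕀 1) ≫ (swp 1 1 ⊠ 𝕀 2) =
      (𝕀 1 ⊠ diag1 ⊠ 𝕀 1) ≫ (swp 1 1 ⊠ 𝕀 2) ≫ (𝕀 1 ⊠ gtof) := by
  have e1 := tens_assoc (𝕀 1) diag1 (𝕀 1)
  have e2 := tens_assoc diag1 (𝕀 1) (𝕀 1)
  have e3 := tens_assoc (swp 1 1) (𝕀 1) (𝕀 1)
  have e4 := tens_assoc (𝕀 1) (swp 1 1) (𝕀 1)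
  rw [reType_rfl] at e1 e2 e3 e4
  rw [id_tens_id] at e2 e3
  have h1 : (swp 1 1 ⊠ 𝕀 1) ≫ (𝕀 1 ⊠ diag1 ⊠ 𝕀 1) = (diag1 ⊠ 𝕀 2) ≫ (swp 2 1 ⊠ 𝕀 1) := by
    rw [← e1, ← e2, comp_tens_id, comp_tens_id, swp_natural]
  have h2 : (swp 1 1 ⊠ 𝕀 1) ≫ (diag1 ⊠ 𝕀 2) = (𝕀 1 ⊠ diag1 ⊠ 𝕀 1) ≫ (swp 1 2 ⊠ 𝕀 1) := by
    rw [← e1, ← e2, comp_tens_id, comp_tens_id, swp_natural]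
  have h3 : swp 1 2 ⊠ 𝕀 1 = (swp 1 1 ⊠ 𝕀 2) ≫ (𝕀 1 ⊠ swp 1 1 ⊠ 𝕀 1) := by
    rw [swp_one_two, ← comp_tens_id, e3, e4]
  have h4 : (swp 2 1 ⊠ 𝕀 1) ≫ (swp 1 1 ⊠ 𝕀 2) = 𝕀 1 ⊠ swp 1 1 ⊠ 𝕀 1 := by
    rw [← e3, comp_tens_id, swp_two_one, Category.assoc, comp_tens_id, swp_swp, id_tens_id,
      Category.comp_id, e4]
  conv_lhs => rw [gtof_swap_controls]
  simp only [Category.assoc]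
  have h5 := gtof_copy_control
  rw [reassoc_of% h1, h4, reassoc_of% h5, reassoc_of% h2, h3]
  simp only [Category.assoc]
  rw [id_tens_comp, id_tens_comp, ← gtof_swap_controls]

theorem diag2_tens_id : diag2 ⊠ 𝕀 1 =
    (diag1 ⊠ 𝕀 2) ≫ (𝕀 1 ⊠ ((𝕀 1 ⊠ diag1 ⊠ 𝕀 1) ≫ (swp 1 1 ⊠ 𝕀 2))) := by
  have e1 := tens_assoc diag1 (𝕀 1) (𝕀 1)
  have e2 := tens_assoc (𝕀 2) diag1 (𝕀 1)
  have e3 := tens_assoc (𝕀 1) (𝕀 1) (diag1 ⊠ 𝕀 1)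
  have e4 := tens_assoc (𝕀 1) (swp 1 1 ⊠ 𝕀 1) (𝕀 1)
  have e5 := tens_assoc (swp 1 1) (𝕀 1) (𝕀 1)
  rw [reType_rfl] at e1 e2 e3 e4 e5
  rw [id_tens_id] at e1 e3 e5
  rw [← id_tens_comp, ← e3, ← e2, ← e5, ← e4, ← e1, comp_tens_id, comp_tens_id, ← Category.assoc,
    tens_eq, diag2]

/-- Both control wires of the Toffoli gate can be copied. -/
theorem gtof_copy_controls : gtof ≫ (diag2 ⊠ 𝕀 1) = (diag2 ⊠ 𝕀 1) ≫ (𝕀 2 ⊠ gtof) := by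
  have h := gtof_copy_control
  have e := tens_assoc (𝕀 1) (𝕀 1) gtof
  rw [reType_rfl, id_tens_id] at e
  rw [diag2_tens_id, reassoc_of% h, id_tens_comp, gtof_copy_second_control, e, Category.assoc,
    id_tens_comp, Category.assoc]

theorem tensorμ_one_one : tensorμ (mk 1) (mk 1) (mk 1) (mk 1) = 𝕀 1 ⊠ swp 1 1 ⊠ 𝕀 1 := by
  change 𝕀 4 ≫ (𝕀 1 ⊠ 𝕀 3) ≫ (𝕀 1 ⊠ swp 1 1 ⊠ 𝕀 1) ≫ (𝕀 1 ⊠ 𝕀 3) ≫ 𝕀 4 = _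
  simp only [id_tens_id, Category.id_comp, Category.comp_id]

theorem tensorμ_two_one : tensorμ (mk 2) (mk 2) (mk 1) (mk 1) = 𝕀 2 ⊠ swp 2 1 ⊠ 𝕀 1 := by
  change 𝕀 6 ≫ (𝕀 2 ⊠ 𝕀 4) ≫ (𝕀 2 ⊠ swp 2 1 ⊠ 𝕀 1) ≫ (𝕀 2 ⊠ 𝕀 4) ≫ 𝕀 6 = _
  simp only [id_tens_id, Category.id_comp, Category.comp_id]

theorem tensorμ_zero_one : tensorμ (mk 0) (mk 0) (mk 1) (mk 1) = 𝕀 2 := by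
  change 𝕀 2 ≫ (𝕀 0 ⊠ 𝕀 2) ≫ (𝕀 0 ⊠ swp 0 1 ⊠ 𝕀 1) ≫ (𝕀 0 ⊠ 𝕀 2) ≫ 𝕀 2 = _
  simp only [id_tens_id, swp_zero_one, Category.comp_id]

theorem diag2_eq : diag2 = tensorDiag (X := mk 1) (Y := mk 1) diag1 diag1 :=
  congrArg ((diag1 ⊠ diag1) ≫ ·) tensorμ_one_one.symm

theorem diag3_eq : diag3 = tensorDiag (X := mk 2) (Y := mk 1) diag2 diag1 :=
  congrArg ((diag2 ⊠ diag1) ≫ ·) tensorμ_two_one.symm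

theorem diag2_swap : diag2 ≫ swp 2 2 = diag2 := by
  rw [diag2_eq]
  exact tensorDiag_cocommutative (C := TOF) (X := mk 1) (Y := mk 1) diag1_swap diag1_swap

/-- The gate may use the upper copy of the controls instead of the lower one because `diag2` is
cocommutative. -/
theorem gtof_copy_controls_swap :
    gtof ≫ (diag2 ⊠ 𝕀 1) ≫ (𝕀 2 ⊠ swp 2 1) =
      (diag2 ⊠ 𝕀 1) ≫ (𝕀 2 ⊠ swp 2 1) ≫ (gtof ⊠ 𝕀 2) := by
  have h : diag2 ⊠ 𝕀 1 = (diag2 ⊠ 𝕀 1) ≫ (swp 2 2 ⊠ 𝕀 1) := by rw [comp_tens_id, diag2_swap]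
  have h' := gtof_copy_controls
  have h3 := swp_two_three
  rw [h]
  simp only [Category.assoc]
  rw [← h3, reassoc_of% h', swp_natural, ← reassoc_of% h3]

/-- Copying the target yields two gates with common controls, one for each copy of the target.
Copying the controls then gives each gate its own pair, and `diag1_swap` absorbs the swaps around
`gtof124`. -/
theorem gtof_diag3 : gtof ≫ diag3 = diag3 ≫ (gtof ⊠ gtof) := by
  have e1 := tens_assoc diag2 (𝕀 1) (𝕀 1)
  have e2 := tens_assoc (𝕀 2) (swp 2 1) (𝕀 1)
  have e3 := tens_assoc (𝕀 2) gtof (𝕀 1)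
  have e4 := tens_assoc (𝕀 2) (𝕀 2) (swp 1 1)
  have e5 := tens_assoc gtof (𝕀 2) (𝕀 1)
  have e6 := tens_assoc (𝕀 2) (𝕀 1) gtof
  rw [reType_rfl] at e1 e2 e3 e4 e5 e6
  rw [id_tens_id] at e1 e4 e5 e6
  have d3 : diag3 = (𝕀 2 ⊠ diag1) ≫ (diag2 ⊠ 𝕀 2) ≫ (𝕀 2 ⊠ swp 2 1 ⊠ 𝕀 1) := by
    rw [← Category.assoc, tens_eq', diag3]
  have h1 : (gtof ⊠ 𝕀 1) ≫ (diag2 ⊠ 𝕀 2) ≫ (𝕀 2 ⊠ swp 2 1 ⊠ 𝕀 1) =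
      (diag2 ⊠ 𝕀 2) ≫ (𝕀 2 ⊠ swp 2 1 ⊠ 𝕀 1) ≫ (gtof ⊠ 𝕀 3) := by
    rw [← e1, ← e2, ← e5, comp_tens_id, comp_tens_id, gtof_copy_controls_swap, comp_tens_id,
      comp_tens_id]
  have h2 : (gtof ⊠ 𝕀 1) ≫ (diag2 ⊠ 𝕀 2) = (diag2 ⊠ 𝕀 2) ≫ (𝕀 2 ⊠ gtof ⊠ 𝕀 1) := by
    rw [← e1, ← e3, comp_tens_id, gtof_copy_controls, comp_tens_id]
  have h3 : (𝕀 2 ⊠ swp 1 1) ≫ (diag2 ⊠ 𝕀 2) = (diag2 ⊠ 𝕀 2) ≫ (𝕀 4 ⊠ swp 1 1) :=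
    (tens_exchange diag2 (swp 1 1)).symm
  have h4 : (𝕀 2 ⊠ diag1) ≫ (𝕀 2 ⊠ swp 1 1) = 𝕀 2 ⊠ diag1 := by
    rw [id_tens_comp, diag1_swap]
  have h5 : (𝕀 2 ⊠ gtof ⊠ 𝕀 1) ≫ (𝕀 4 ⊠ swp 1 1) ≫ (𝕀 2 ⊠ swp 2 1 ⊠ 𝕀 1) =
      (𝕀 4 ⊠ swp 1 1) ≫ (𝕀 2 ⊠ swp 2 1 ⊠ 𝕀 1) ≫ (𝕀 3 ⊠ gtof) := by
    rw [e4, e6, id_tens_comp, id_tens_comp, ← swp_three_one, swp_natural, swp_three_one,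
      id_tens_comp, id_tens_comp, Category.assoc]
  have h6 := gtof_copy_target
  have h7 := tens_eq' gtof gtof
  rw [d3, reassoc_of% h6, h1, gtof124]
  simp only [Category.assoc]
  rw [reassoc_of% h4, reassoc_of% h3, reassoc_of% h2, reassoc_of% h5, h7, ← reassoc_of% h3,
    reassoc_of% h4]

/-! ### The diagonal -/

theorem flipFunctor_isMonoidal : flipFunctor.IsMonoidal (C := TOF) where
  dag_dag f := Quotient.inductionOn f fun c => congrArg ofCircuit (flip_flip c)
  dag_tensor f g := Quotient.inductionOn₂ f g fun _ _ => rfl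
  dag_associator _ _ _ := congrArg ofCircuit (flip_cast _)
  dag_braiding _ _ := rfl

theorem dag_diag1 : flipFunctor.dag diag1 = codiag1 := by
  change ofCircuit cnot.flip ≫ (𝕀 1 ⊠ ofCircuit zeroIn.flip) = _
  rw [Unitary.flip_cnot, flip_zeroIn, codiag1]

theorem diag1_isSemiFrobenius : flipFunctor.IsSemiFrobenius (X := mk 1) diag1 where
  total := (congrArg (diag1 ≫ ·) dag_diag1).trans diag1_codiag1
  cocommutative := diag1_swap
  coassociative := (congrArg (diag1 ≫ ·) (Category.comp_id _)).trans diag1_coassoc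
  left := by
    change ((diag1 ⊠ 𝕀 1) ≫ 𝕀 3) ≫ (𝕀 1 ⊠ flipFunctor.dag diag1) = flipFunctor.dag diag1 ≫ diag1
    rw [dag_diag1, Category.comp_id, diag1_semiFrobenius]

theorem gcnot_bra1 : gcnot ≫ (bra1 ⊠ 𝕀 1) = bra1 ⊠ gnot := by
  have h : ofCircuit cnot.flip ≫ (bra1 ⊠ 𝕀 1) = bra1 ⊠ ofCircuit TofCircuit.not.flip :=
    congrArg flipFunctor.dag ket1_gcnot
  rwa [Unitary.flip_cnot, flip_not] at h

theorem diag1_bra1 : diag1 ≫ (bra1 ⊠ 𝕀 1) = bra1 ≫ ket1 := by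
  have e : (𝕀 1 ⊠ ket0) ≫ (bra1 ⊠ gnot) = (bra1 ⊠ 𝕀 0) ≫ (𝕀 0 ⊠ ket1) := by
    rw [tens_comp, tens_eq, ket0_gnot, Category.id_comp]
  rw [diag1_def, Category.assoc, gcnot_bra1, e, tens_zero, zero_tens, reType_rfl]

theorem ket1_codiag1 : (ket1 ⊠ 𝕀 1) ≫ codiag1 = bra1 ≫ ket1 := by
  have h : (ket1 ⊠ 𝕀 1) ≫ flipFunctor.dag diag1 = bra1 ≫ ket1 := congrArg flipFunctor.dag diag1_bra1
  rwa [dag_diag1] at h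

theorem diag1_bra1_bra1 : diag1 ≫ (bra1 ⊠ bra1) = bra1 := by
  rw [← tens_eq, ← Category.assoc, diag1_bra1, zero_tens, reType_rfl, Category.assoc, ket1_bra1,
    Category.comp_id]

/-- The definition recurses only from two wires on; this extends the recursion down to `n = 0`,
where the interleaving is trivial. -/
theorem diagonalNat_succ (n : ℕ) :
    diagonalNat (n + 1) = tensorDiag (X := mk n) (Y := mk 1) (diagonalNat n) diag1 := by
  cases n with
  | zero =>
    change diag1 = (𝕀 0 ⊠ diag1) ≫ tensorμ (mk 0) (mk 0) (mk 1) (mk 1)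
    rw [tensorμ_zero_one, zero_tens, reType_rfl, Category.comp_id]
  | succ n => rfl

theorem tensorμ_zero_zero (n m : ℕ) : tensorμ (mk n) (mk m) (mk 0) (mk 0) = 𝕀 (n + m) := by
  have h : 𝕀 (n + m) = (𝕀 (n + m) ⊠ 𝕀 0) ≫ tensorμ (mk n) (mk m) (mk 0) (mk 0) ≫ (𝕀 n ⊠ 𝕀 m) :=
    tensor_right_unitality (C := TOF) (mk n) (mk m)
  rw [id_tens_id, id_tens_id] at h
  exact ((Category.id_comp _).symm.trans
    (congrArg (𝕀 (n + m) ≫ ·) (Category.comp_id _).symm)).trans h.symm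

theorem diagonalNat_add (n m : ℕ) :
    diagonalNat (n + m) = tensorDiag (X := mk n) (Y := mk m) (diagonalNat n) (diagonalNat m) := by
  induction m with
  | zero =>
    change diagonalNat n = (diagonalNat n ⊠ 𝕀 0) ≫ tensorμ (mk n) (mk n) (mk 0) (mk 0)
    rw [tensorμ_zero_zero, tens_zero]
    exact (Category.comp_id _).symm
  | succ m ih =>
    rw [diagonalNat_succ m]
    refine (diagonalNat_succ (n + m)).trans ?_
    rw [ih]
    have h := associator_comp_tensorDiag (C := TOF) (X := mk n) (Y := mk m) (Z := mk 1)
      (diagonalNat n) (diagonalNat m) diag1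
    have h1 : (α_ (mk n) (mk m) (mk 1)).hom = 𝟙 ((mk n ⊗ mk m) ⊗ mk 1) := rfl
    rw [h1, id_tensorHom_id] at h
    exact (Category.comp_id _).symm.trans (h.trans (Category.id_comp _))

theorem diagonal_tensor (X Y : TOF) : diagonal (X ⊗ Y) = tensorDiag (diagonal X) (diagonal Y) :=
  diagonalNat_add X.wires Y.wires

theorem diagonal_isSemiFrobenius (X : TOF) : flipFunctor.IsSemiFrobenius (diagonal X) := by
  obtain ⟨n⟩ := X
  induction n with
  | zero =>
    change flipFunctor.IsSemiFrobenius (X := mk 0) (𝕀 0)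
    exact {
      total := Category.comp_id _
      cocommutative := (Category.id_comp _).trans swp_zero_zero
      coassociative := congrArg (𝕀 0 ≫ ·) (Category.comp_id (𝕀 0 ⊠ 𝕀 0))
      left := by
        change ((𝕀 0 ⊠ 𝕀 0) ≫ 𝕀 0) ≫ (𝕀 0 ⊠ 𝕀 0) = 𝕀 0 ≫ 𝕀 0
        rw [id_tens_id, Category.comp_id] }
  | succ n ih =>
    have h := ih.tensorDiag flipFunctor_isMonoidal diag1_isSemiFrobenius
    have e : diagonal (mk (n + 1)) = tensorDiag (X := mk n) (Y := mk 1) (diagonalNat n) diag1 :=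
      diagonalNat_succ n
    rw [e]
    exact h

/-! ### The generators and the induction over circuits -/

theorem ket1_isPartialIso :
    flipFunctor.IsPartialIso (diagonal (mk 0)) (diagonal (mk 1)) ket1 where
  natural := ket1_diag1.trans (Category.id_comp _).symm
  natural_dag := (Category.comp_id _).trans diag1_bra1_bra1.symm
  comp_dag_comp := by
    change ket1 ≫ bra1 ≫ ket1 = ket1
    rw [← Category.assoc, ket1_bra1, Category.id_comp]
  latch := by
    have h : ket1 ≫ flipFunctor.dag ket1 = 𝕀 0 := ket1_bra1
    rw [h]
    exact .id (diagonal_isSemiFrobenius _)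
  latch_dag := by
    change diag1 ≫ ((bra1 ≫ ket1) ⊠ 𝕀 1) ≫ flipFunctor.dag diag1 = bra1 ≫ ket1
    rw [dag_diag1, ← comp_tens_id, Category.assoc, ket1_codiag1, ← Category.assoc, diag1_bra1,
      Category.assoc, ← Category.assoc ket1, ket1_bra1, Category.id_comp]

theorem ofCircuit_isPartialIso {n m : ℕ} (c : TofCircuit n m) :
    flipFunctor.IsPartialIso (diagonal (mk n)) (diagonal (mk m)) (ofCircuit c) := by
  have hD := flipFunctor_isMonoidal
  have hF := diagonal_isSemiFrobenius
  induction c with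
  | id n =>
    refine .of_inverse (hF _) (hF _) ?_ (Category.id_comp _) (Category.id_comp _)
    rw [ofCircuit_id, id_tensorHom_id, Category.id_comp]
    exact (Category.comp_id _).symm
  | comp c d hc hd => exact .comp hD (hF _) (hF _) (hF _) hc hd
  | @tensor n m n' m' c d hc hd =>
    have h := hc.tensor hD hd
    rw [← diagonal_tensor, ← diagonal_tensor] at h
    exact h
  | swap n m =>
    refine .of_inverse (hF _) (hF _) ?_ (swp_swp n m) (swp_swp m n)
    have h := braiding_comp_tensorDiag (diagonal (mk n)) (diagonal (mk m))
    rw [← diagonal_tensor, ← diagonal_tensor] at h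
    exact h
  | oneIn => exact ket1_isPartialIso
  | oneOut => exact ket1_isPartialIso.dag hD
  | tof =>
    refine .of_inverse (hF _) (hF _) ?_ gtof_gtof gtof_gtof
    have e : diagonal (mk 3) = diag3 := by
      rw [diag3_eq, diag2_eq]
      rfl
    rw [e]
    exact gtof_diag3

theorem isPartialIso {X Y : TOF} (f : X ⟶ Y) :
    flipFunctor.IsPartialIso (diagonal X) (diagonal Y) f :=
  Quotient.inductionOn f fun c => ofCircuit_isPartialIso c

theorem flipFunctor_isInverse : flipFunctor.IsInverse where
  dag_dag := flipFunctor_isMonoidal.dag_dag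
  comp_dag_comp f := (isPartialIso f).comp_dag_comp
  comm f g := (isPartialIso f).latch.comm flipFunctor_isMonoidal (diagonal_isSemiFrobenius _)
    (isPartialIso g).latch

theorem diagonal_isInverseProduct : flipFunctor.IsInverseProduct diagonal where
  dag_tensor := flipFunctor_isMonoidal.dag_tensor
  natural f := (isPartialIso f).natural
  total A := (diagonal_isSemiFrobenius A).total
  cocommutative A := (diagonal_isSemiFrobenius A).cocommutative
  coassociative A := (diagonal_isSemiFrobenius A).coassociative
  semiFrobenius_left A := (diagonal_isSemiFrobenius A).left
  semiFrobenius_right A := (diagonal_isSemiFrobenius A).right flipFunctor_isMonoidal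
  uniformCopying A B := by
    rw [diagonal_tensor, tensorDiag, tensorμ, flipFunctor_isMonoidal.dag_associator,
      flipFunctor_isMonoidal.dag_associator]
    simp only [id_tensorHom, tensorHom_id]

end TOF

theorem mainTheorem2 :
    ∃ D : OpFunctor TOF,
      (∀ {n m : ℕ} (c : TofCircuit n m), D.dag (TOF.ofCircuit c) = TOF.ofCircuit c.flip) ∧
      D.IsInverse ∧
      (∃ R : RestrictionStructure TOF,
        (∀ {X Y : TOF} (f : X ⟶ Y), R.rst f = f ≫ D.dag f) ∧
        (∀ {X Y : TOF} (f : X ⟶ Y), R.IsPartialInverse f (D.dag f))) ∧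
      D.IsInverseProduct TOF.diagonal ∧
      (∀ {X Y : TOF} (f : X ⟶ Y),
        TOF.diagonal X ≫ ((f ≫ D.dag f) ⊗ₘ 𝟙 X) ≫ D.dag (TOF.diagonal X) = f ≫ D.dag f) := by
  have hI := TOF.flipFunctor_isInverse
  refine ⟨TOF.flipFunctor, fun _ => rfl, hI, ⟨hI.restriction, fun _ => rfl, fun f => ⟨rfl, ?_⟩⟩,
    TOF.diagonal_isInverseProduct, fun f => (TOF.isPartialIso f).latch⟩
  -- The restriction of `f°` is `f° f°°`, so only `f°° = f` is needed.
  exact congrArg (TOF.flipFunctor.dag f ≫ ·) (hI.dag_dag f)
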